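/- **Theorem 7.4 (the 1-skeleton of a Coxeter complex is a standard model).** *Coxeter complexes.* Let $d\ge 1$. A triangulation of $\mathbb{R}^d$ is a locally finite simplicial complex $K$ of (straight) simplices in $\mathbb{R}^d$ whose union is $\mathbb{R}^d$. Let $\Gamma$ be the group of isometries of $\mathbb{R}^d$ generated by all orthogonal reflections in the hyperplanes spanned by the facets (the $(d-1)$-dimensional faces) of the $d$-dimensional simplices of $K$. We call $K$ a (Euclidean) Coxeter complex if (a) $\Gamma$ preserves the triangulation, and (b) $\Gamma$ acts transitively on the set of $d$-dimensional simplices of $K$. *Topological crystals.* Graphs may have loops and multiple edges; each edge has two directions, $o(e)$, $t(e)$, $\overline e$ denote origin, terminus and inverse of a directed edge $e$, and $C_1(X_0,\mathbb{R})$, in which $\overline e=-e$, carries the inner product for which every orientation of $X_0$ is an orthonormal basis. A $d$-dimensional topological crystal is a connected graph $X$ with an abelian covering map $\pi:X\to X_0$ onto a finite graph $X_0$ whose covering transformation group $L$ is free abelian of rank $d$. Its vanishing subgroup $H\subset H_1(X_0,\mathbb{Z})$ is the kernel of the canonical homomorphism $H_1(X_0,\mathbb{Z})\to L$ (equivalently,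 the image of $H_1(X,\mathbb{Z})$). A periodic realization is a piecewise linear map $\varPhi:X\to\mathbb{R}^d$, given by its values on vertices, such that $\varPhi(\sigma x)=\varPhi(x)+\rho(\sigma)$ for $\sigma\in L$, where $\rho:L\to\mathbb{R}^d$ is an injective homomorphism whose image is a lattice in $\mathbb{R}^d$. *Standard realizations.* Let $P_0:C_1(X_0,\mathbb{R})\to H_1(X_0,\mathbb{R})$ be the orthogonal projection, $H_{\mathbb{R}}$ the subspace of $H_1(X_0,\mathbb{R})$ spanned by $H$, and $P:H_1(X_0,\mathbb{R})\to H_{\mathbb{R}}^{\perp}$ the orthogonal projection onto the orthogonal complement of $H_{\mathbb{R}}$ in $H_1(X_0,\mathbb{R})$. A periodic realization $\varPhi_0$ is a normalized standard realization if, for some linear isometry of $H_{\mathbb{R}}^{\perp}$ onto $\mathbb{R}^d$ used as an identification, $\varPhi_0(t(e))-\varPhi_0(o(e))=P(P_0(\pi(e)))$ for all directed edges $e$ of $X$. A standard realization is a composition of a normalized standard realization with a similarity of $\mathbb{R}^d$. **Statement.** Let $K$ be a Coxeter complex in $\mathbb{R}^d$, $d\geq 1$, let $X$ be its 1-skeleton,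 regarded as a graph, and let $\varPhi:X\to\mathbb{R}^d$ be the inclusion. Then 1. $X$ carries the structure of a $d$-dimensional topological crystal for which $\varPhi$ is a periodic realization whose period lattice $\rho(L)$ consists of translations belonging to $\Gamma$; 2. for every structure of a $d$-dimensional topological crystal on $X$ for which $\varPhi$ is a periodic realization, $\varPhi$ is a standard realization. -/

import Mathlib

/-! ### Graphs, chains and homology -/

/-- A graph given by its vertices `V` and its *directed* edges `E`: every directed edge has an
origin, a terminus and an inverse edge. Loops and multiple edges are allowed. -/
structure DirGraph (V E : Type*) where
  /-- the origin of a directed edge -/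
  o : E → V
  /-- the terminus of a directed edge -/
  t : E → V
  /-- the inverse of a directed edge -/
  inv : E → E
  inv_inv : ∀ e, inv (inv e) = e
  inv_ne : ∀ e, inv e ≠ e
  o_inv : ∀ e, o (inv e) = t e
  t_inv : ∀ e, t (inv e) = o e

/-- The graph of directed edges of a simple graph. -/
def SimpleGraph.toDirGraph {V : Type*} (G : SimpleGraph V) : DirGraph V G.Dart where
  o e := e.fst
  t e := e.snd
  inv e := e.symm
  inv_inv e := e.symm_symm
  inv_ne e := e.symm_ne
  o_inv _ := rfl
  t_inv _ := rfl

namespace DirGraph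

variable {V E : Type*}

/-- A graph is connected if it is nonempty and any two vertices are joined by an edge path. -/
def Connected (X : DirGraph V E) : Prop :=
  Nonempty V ∧ ∀ x y : V, Relation.ReflTransGen (fun a b => ∃ e, X.o e = a ∧ X.t e = b) x y

/-- The finitely supported functions `c` on directed edges with `c ē = - c e`. -/
def antisymm (X : DirGraph V E) (R : Type*) [CommRing R] : Submodule R (E →₀ R) where
  carrier := {c | ∀ e, c (X.inv e) = - c e}
  add_mem' {a b} ha hb e := by simp [ha e, hb e, add_comm]
  zero_mem' e := by simp
  smul_mem' r a ha e := by simp [ha e]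

/-- The group `C₁(X, R)` of 1-chains (every directed edge is identified with minus its inverse),
realized as the finitely supported functions `c` on directed edges with `c ē = - c e`. If `Eᵒ`
is an orientation, then `c` stands for the chain `∑ e ∈ Eᵒ, c e • e`. -/
def C₁ (X : DirGraph V E) (R : Type*) [CommRing R] : Type _ := ↥(X.antisymm R)

noncomputable instance (X : DirGraph V E) (R : Type*) [CommRing R] : AddCommGroup (X.C₁ R) :=
  inferInstanceAs (AddCommGroup ↥(X.antisymm R))

noncomputable instance (X : DirGraph V E) (R : Type*) [CommRing R] : Module R (X.C₁ R) :=
  inferInstanceAs (Module R ↥(X.antisymm R))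

/-- The function on directed edges underlying a 1-chain. -/
noncomputable def coeff (X : DirGraph V E) (R : Type*) [CommRing R] : X.C₁ R →ₗ[R] (E →₀ R) :=
  (X.antisymm R).subtype

theorem coeff_injective (X : DirGraph V E) (R : Type*) [CommRing R] :
    Function.Injective (X.coeff R) :=
  (X.antisymm R).injective_subtype

theorem coeff_inv (X : DirGraph V E) (R : Type*) [CommRing R] (c : X.C₁ R) (e : E) :
    X.coeff R c (X.inv e) = - X.coeff R c e :=
  c.2 e

theorem inv_injective (X : DirGraph V E) : Function.Injective X.inv := fun a b h => by
  rw [← X.inv_inv a, h, X.inv_inv]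

/-- The directed edge `e`, as a 1-chain. -/
noncomputable def edgeChain (X : DirGraph V E) (R : Type*) [CommRing R] (e : E) : X.C₁ R :=
  ⟨Finsupp.single e 1 - Finsupp.single (X.inv e) 1, by
    classical
    intro f
    have h1 : X.inv e = X.inv f ↔ e = f := X.inv_injective.eq_iff
    have h2 : e = X.inv f ↔ X.inv e = f :=
      ⟨fun h => by rw [h, X.inv_inv], fun h => by rw [← h, X.inv_inv]⟩
    simp [Finsupp.single_apply, h1, h2]⟩

theorem coeff_edgeChain (X : DirGraph V E) (R : Type*) [CommRing R] (e : E) :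
    X.coeff R (X.edgeChain R e) = Finsupp.single e 1 - Finsupp.single (X.inv e) 1 := rfl

/-- The boundary operator `∂ : C₁(X, R) → C₀(X, R)` with `∂ e = t e - o e`. On a chain
`c = ∑ e ∈ Eᵒ, c e • e` its value is `∑ e ∈ E, c e • t e`, because `c ē = - c e`. -/
noncomputable def boundary (X : DirGraph V E) (R : Type*) [CommRing R] : X.C₁ R →ₗ[R] (V →₀ R) :=
  (Finsupp.lmapDomain R R X.t).comp (X.coeff R)

theorem boundary_edgeChain (X : DirGraph V E) (R : Type*) [CommRing R] (e : E) :
    X.boundary R (X.edgeChain R e) = Finsupp.single (X.t e) 1 - Finsupp.single (X.o e) 1 := by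
  rw [boundary, LinearMap.comp_apply, coeff_edgeChain, map_sub]
  simp [Finsupp.mapDomain_single, X.t_inv]

/-- The homology group `H₁(X, R) = ker ∂`, as a submodule of `C₁(X, R)`. -/
noncomputable def H₁ (X : DirGraph V E) (R : Type*) [CommRing R] : Submodule R (X.C₁ R) :=
  LinearMap.ker (X.boundary R)

/-- The natural map `C₁(X, ℤ) → C₁(X, ℝ)`. -/
noncomputable def intToReal (X : DirGraph V E) : X.C₁ ℤ →+ X.C₁ ℝ :=
  AddMonoidHom.codRestrict
    ((Finsupp.mapRange.addMonoidHom (Int.castAddHom ℝ)).comp (X.coeff ℤ).toAddMonoidHom)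
    (X.antisymm ℝ) (fun c e => by
      have h := X.coeff_inv ℤ c e
      simp [h])

theorem coeff_intToReal (X : DirGraph V E) (c : X.C₁ ℤ) (e : E) :
    X.coeff ℝ (X.intToReal c) e = (X.coeff ℤ c e : ℝ) := rfl

/-- The inner product on `C₁(X, ℝ)` for which every orientation of `X` is an orthonormal basis:
`⟨c, c'⟩ = ∑ e ∈ Eᵒ, c e * c' e = (1 / 2) * ∑ e ∈ E, c e * c' e`. -/
@[reducible] noncomputable def chainCore (X : DirGraph V E) :
    InnerProductSpace.Core ℝ (X.C₁ ℝ) where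
  inner c c' := (1 / 2) * (X.coeff ℝ c).sum fun e a => a * X.coeff ℝ c' e
  conj_inner_symm c c' := by
    classical
    have key : ∀ a b : E →₀ ℝ, (a.sum fun e r => r * b e) =
        ∑ e ∈ a.support ∪ b.support, a e * b e := fun a b =>
      Finsupp.sum_of_support_subset a Finset.subset_union_left _ (by simp)
    simp only [key, conj_trivial]
    rw [Finset.union_comm]
    simp only [mul_comm]
  re_inner_nonneg c := by
    have : 0 ≤ (X.coeff ℝ c).sum fun e a => a * X.coeff ℝ c e :=
      Finset.sum_nonneg fun e _ => mul_self_nonneg _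
    simpa using this
  add_left a b c := by
    have := Finsupp.sum_add_index' (f := X.coeff ℝ a) (g := X.coeff ℝ b)
      (h := fun e r => r * X.coeff ℝ c e) (by simp) (by intros; ring)
    simp only [map_add, this]
    ring
  smul_left a b r := by
    have := Finsupp.sum_smul_index' (g := X.coeff ℝ a) (b := r)
      (h := fun e s => s * X.coeff ℝ b e) (by simp)
    simp only [map_smul, this, smul_eq_mul, conj_trivial, mul_assoc, ← Finsupp.mul_sum]
    ring
  definite c hc := by
    have h0 : (X.coeff ℝ c).sum (fun e a => a * X.coeff ℝ c e) = 0 := by linarith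
    have h1 := (Finset.sum_eq_zero_iff_of_nonneg
      (fun e _ => mul_self_nonneg (X.coeff ℝ c e))).1 h0
    apply X.coeff_injective ℝ
    ext e
    by_cases he : e ∈ (X.coeff ℝ c).support
    · simpa using h1 e he
    · simpa using he

noncomputable instance (X : DirGraph V E) : NormedAddCommGroup (X.C₁ ℝ) :=
  X.chainCore.toNormedAddCommGroup

noncomputable instance (X : DirGraph V E) : InnerProductSpace ℝ (X.C₁ ℝ) :=
  InnerProductSpace.ofCore X.chainCore.toCore

theorem inner_def (X : DirGraph V E) (c c' : X.C₁ ℝ) :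
    inner ℝ c c' = (1 / 2) * (X.coeff ℝ c).sum fun e a => a * X.coeff ℝ c' e := rfl

instance (X : DirGraph V E) [Finite E] : FiniteDimensional ℝ (X.C₁ ℝ) :=
  Module.Finite.of_injective (X.coeff ℝ) (X.coeff_injective ℝ)

end DirGraph

/-! ### Topological crystals -/

/-- A structure of `d`-dimensional topological crystal on a graph `X`: the connected graph `X` is
an abelian covering graph over a finite graph `base`, and its covering transformation group is the
free abelian group `L` of rank `d`. (As `X` is connected and `L` acts simply transitively on the
fibres, `L` is the whole group of covering transformations.) -/
structure TopologicalCrystal {V E : Type*} (X : DirGraph V E) (d : ℕ) where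
  connected : X.Connected
  /-- vertices of the base graph -/
  V₀ : Type*
  /-- directed edges of the base graph -/
  E₀ : Type*
  [finite_V₀ : Finite V₀]
  [finite_E₀ : Finite E₀]
  /-- the finite base graph -/
  base : DirGraph V₀ E₀
  /-- the covering map on vertices -/
  projV : V → V₀
  /-- the covering map on directed edges -/
  projE : E → E₀
  proj_o : ∀ e, base.o (projE e) = projV (X.o e)
  proj_t : ∀ e, base.t (projE e) = projV (X.t e)
  proj_inv : ∀ e, base.inv (projE e) = projE (X.inv e)
  proj_surjective : Function.Surjective projV
  /-- the covering map is a local isomorphism -/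
  proj_bijOn : ∀ x, Set.BijOn projE {e | X.o e = x} {f | base.o f = projV x}
  /-- the covering transformation group -/
  L : Type*
  [addCommGroup_L : AddCommGroup L]
  [free_L : Module.Free ℤ L]
  [finite_L : Module.Finite ℤ L]
  finrank_L : Module.finrank ℤ L = d
  [actV : AddAction L V]
  [actE : AddAction L E]
  act_o : ∀ (σ : L) e, X.o (σ +ᵥ e) = σ +ᵥ X.o e
  act_t : ∀ (σ : L) e, X.t (σ +ᵥ e) = σ +ᵥ X.t e
  act_inv : ∀ (σ : L) e, X.inv (σ +ᵥ e) = σ +ᵥ X.inv e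
  act_free : ∀ (σ : L) (x : V), σ +ᵥ x = x → σ = 0
  projE_act : ∀ (σ : L) e, projE (σ +ᵥ e) = projE e
  projV_eq_iff : ∀ x y, projV x = projV y ↔ ∃ σ : L, σ +ᵥ x = y

namespace TopologicalCrystal

attribute [instance] finite_V₀ finite_E₀ addCommGroup_L free_L finite_L actV actE

variable {V E : Type*} {X : DirGraph V E} {d : ℕ}

/-- The map `C₁(X, ℤ) → C₁(X₀, ℤ)` induced by the covering map, which sends `e` to its image. -/
noncomputable def push (C : TopologicalCrystal X d) : X.C₁ ℤ →ₗ[ℤ] C.base.C₁ ℤ :=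
  ((Finsupp.lmapDomain ℤ ℤ C.projE).comp (X.coeff ℤ)).codRestrict (C.base.antisymm ℤ) (by
    intro c f
    have h1 : Finsupp.mapDomain X.inv (X.coeff ℤ c) = - X.coeff ℤ c := by
      ext e
      have h := Finsupp.mapDomain_apply X.inv_injective (X.coeff ℤ c) (X.inv e)
      rw [X.inv_inv, X.coeff_inv] at h
      simpa using h
    have h2 : Finsupp.mapDomain C.base.inv (Finsupp.mapDomain C.projE (X.coeff ℤ c)) =
        - Finsupp.mapDomain C.projE (X.coeff ℤ c) := by
      rw [← Finsupp.mapDomain_comp, show C.base.inv ∘ C.projE = C.projE ∘ X.inv from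
        funext C.proj_inv, Finsupp.mapDomain_comp, h1]
      exact map_neg (Finsupp.mapDomain.addMonoidHom C.projE) _
    have h3 := DFunLike.congr_fun h2 (C.base.inv f)
    rw [Finsupp.mapDomain_apply C.base.inv_injective, Finsupp.neg_apply] at h3
    simp only [LinearMap.comp_apply, Finsupp.lmapDomain_apply]
    rw [h3, neg_neg])

theorem coeff_push (C : TopologicalCrystal X d) (c : X.C₁ ℤ) :
    C.base.coeff ℤ (C.push c) = Finsupp.mapDomain C.projE (X.coeff ℤ c) := rfl

/-- The vanishing subgroup `H ⊆ H₁(X₀, ℤ)` of the covering graph `X → X₀`: the image of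
`H₁(X, ℤ)`, or, what is the same, the kernel of the canonical homomorphism `H₁(X₀, ℤ) → L`. -/
noncomputable def vanishing (C : TopologicalCrystal X d) : Submodule ℤ (C.base.C₁ ℤ) :=
  (X.H₁ ℤ).map C.push

/-- The subspace `H_ℝ` of `H₁(X₀, ℝ)` spanned by the vanishing subgroup. -/
noncomputable def vanishingReal (C : TopologicalCrystal X d) : Submodule ℝ (C.base.C₁ ℝ) :=
  Submodule.span ℝ (C.base.intToReal '' (C.vanishing : Set (C.base.C₁ ℤ)))

/-- The orthogonal complement of `H_ℝ` in `H₁(X₀, ℝ)`. -/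
noncomputable def vanishingPerp (C : TopologicalCrystal X d) : Submodule ℝ (C.base.C₁ ℝ) :=
  C.vanishingRealᗮ ⊓ C.base.H₁ ℝ

/-- `P (P₀ f)` for a directed edge `f` of the base graph, where `P₀ : C₁(X₀, ℝ) → H₁(X₀, ℝ)` and
`P : H₁(X₀, ℝ) → H_ℝ^⊥` are the orthogonal projections. -/
noncomputable def standardCochain (C : TopologicalCrystal X d) (f : C.E₀) : C.vanishingPerp :=
  C.vanishingPerp.orthogonalProjectionOnto
    ((C.base.H₁ ℝ).orthogonalProjectionOnto (C.base.edgeChain ℝ f) : C.base.C₁ ℝ)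

/-- `ρ` is the period homomorphism of the map `Φ`: it is injective, its image is a lattice of
`ℝᵈ`, and `Φ (σ x) = Φ x + ρ σ`. A piecewise linear map `X → ℝᵈ` is given by its values `Φ` on
the vertices, the edges being mapped to line segments. -/
def IsPeriodHom (C : TopologicalCrystal X d) (Φ : V → EuclideanSpace ℝ (Fin d))
    (ρ : C.L →+ EuclideanSpace ℝ (Fin d)) : Prop :=
  Function.Injective ρ ∧
  DiscreteTopology ρ.range ∧
  Submodule.span ℝ (Set.range ρ) = ⊤ ∧
  ∀ (σ : C.L) (x : V), Φ (σ +ᵥ x) = Φ x + ρ σ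

/-- `Φ` is a periodic realization of the topological crystal. -/
def IsRealization (C : TopologicalCrystal X d) (Φ : V → EuclideanSpace ℝ (Fin d)) : Prop :=
  ∃ ρ : C.L →+ EuclideanSpace ℝ (Fin d), C.IsPeriodHom Φ ρ

/-- `Φ` is a normalized standard realization: after an identification `φ` of the Euclidean space
`H_ℝ^⊥` with `ℝᵈ` its building cochain is `f ↦ P (P₀ f)`. -/
def IsNormalizedStandard (C : TopologicalCrystal X d) (Φ : V → EuclideanSpace ℝ (Fin d)) : Prop :=
  C.IsRealization Φ ∧
  ∃ φ : C.vanishingPerp ≃ₗᵢ[ℝ] EuclideanSpace ℝ (Fin d),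
    ∀ e, Φ (X.t e) - Φ (X.o e) = φ (C.standardCochain (C.projE e))

/-- `Φ` is a standard realization: it is obtained from a normalized one by a similarity
`p ↦ r U p + b` with `r > 0` and `U` orthogonal. -/
def IsStandard (C : TopologicalCrystal X d) (Φ : V → EuclideanSpace ℝ (Fin d)) : Prop :=
  ∃ Φ₀, C.IsNormalizedStandard Φ₀ ∧
    ∃ (r : ℝ) (U : EuclideanSpace ℝ (Fin d) ≃ₗᵢ[ℝ] EuclideanSpace ℝ (Fin d))
      (b : EuclideanSpace ℝ (Fin d)), 0 < r ∧ ∀ x, Φ x = r • U (Φ₀ x) + b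

end TopologicalCrystal

/-! ### Coxeter complexes -/

namespace Geometry.SimplicialComplex

variable {d : ℕ}

/-- A simplicial complex in `ℝᵈ` is a triangulation of `ℝᵈ` if its simplices cover `ℝᵈ` and form a
locally finite family. -/
def IsTriangulation (K : SimplicialComplex ℝ (EuclideanSpace ℝ (Fin d))) : Prop :=
  K.space = Set.univ ∧
  LocallyFinite fun s : K.faces => convexHull ℝ (s.1 : Set (EuclideanSpace ℝ (Fin d)))

/-- The (vertex sets of the) `d`-dimensional simplices. -/
def chambers (K : SimplicialComplex ℝ (EuclideanSpace ℝ (Fin d))) :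
    Set (Finset (EuclideanSpace ℝ (Fin d))) :=
  {s | s ∈ K.faces ∧ s.card = d + 1}

/-- The reflections in the hyperplanes spanned by the `(d - 1)`-dimensional faces of the
`d`-dimensional simplices. -/
noncomputable def facetReflections (K : SimplicialComplex ℝ (EuclideanSpace ℝ (Fin d))) :
    Set (EuclideanSpace ℝ (Fin d) ≃ᵃⁱ[ℝ] EuclideanSpace ℝ (Fin d)) :=
  {g | ∃ s ∈ K.chambers, ∃ t ⊆ s, t.card = d ∧
    ∃ _ : Nonempty (affineSpan ℝ (t : Set (EuclideanSpace ℝ (Fin d)))),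
      g = EuclideanGeometry.reflection (affineSpan ℝ (t : Set (EuclideanSpace ℝ (Fin d))))}

/-- The group `Γ` generated by the facet reflections. -/
noncomputable def reflectionGroup (K : SimplicialComplex ℝ (EuclideanSpace ℝ (Fin d))) :
    Subgroup (EuclideanSpace ℝ (Fin d) ≃ᵃⁱ[ℝ] EuclideanSpace ℝ (Fin d)) :=
  Subgroup.closure K.facetReflections

/-- A Euclidean Coxeter complex: a triangulation of `ℝᵈ` which is preserved by the group `Γ`
generated by the facet reflections, such that `Γ` is transitive on the `d`-simplices. -/
structure IsCoxeterComplex (K : SimplicialComplex ℝ (EuclideanSpace ℝ (Fin d))) : Prop where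
  isTriangulation : K.IsTriangulation
  preserves : ∀ g ∈ K.reflectionGroup, ∀ s ∈ K.faces, s.map g.toEquiv.toEmbedding ∈ K.faces
  transitive : ∀ s ∈ K.chambers, ∀ s' ∈ K.chambers,
    ∃ g ∈ K.reflectionGroup, s.map g.toEquiv.toEmbedding = s'

/-- The 1-skeleton of a simplicial complex, as a graph on its vertices. -/
noncomputable def oneSkeleton (K : SimplicialComplex ℝ (EuclideanSpace ℝ (Fin d))) : SimpleGraph K.vertices where
  Adj x y := x ≠ y ∧ ∃ s ∈ K.faces, (s : Set (EuclideanSpace ℝ (Fin d))) = {x.1, y.1}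
  symm := ⟨fun x y ⟨h, s, hs, e⟩ => ⟨h.symm, s, hs, by rw [e, Set.pair_comm]⟩⟩
  loopless := ⟨fun x h => h.1 rfl⟩

end Geometry.SimplicialComplex

/-! A periodic realization is standard as soon as it is harmonic (the edge vectors at each vertex
sum to zero) and its edge vectors `w f` over the base graph form a tight frame, `∑ ⟨w f, u⟩ w f = k
u` with `k > 0`. Indeed `T v = (f ↦ ⟨w f, v⟩)` is then a chain on the base graph. It is orthogonal
to the vanishing subgroup because edge vectors add up to zero along closed paths of `X`; it is a
cycle by harmonicity; and `T` is a similarity by tightness. Since `H_ℝ^⊥` has dimension at most `d`,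
`T` is onto, and its adjoint identifies `P (P₀ f)` with a multiple of `w f` (`isStandard_of_tight`).

Both conditions follow from the facet normals `n y` of one chamber. They span, and they satisfy a
relation `∑ c y • n y = 0` with all `c y ≠ 0`, unique up to scale. The sum of edge vectors at a
vertex `x` is fixed by the reflections in the facets through `x`, hence is orthogonal to all normals
but one, and by the relation to that one too (`eq_zero_of_fixed`). The frame operator commutes with
the linear part of `Γ`, so every `n y` is an eigenvector, and the relation forces equal eigenvalues
(`exists_scalar`). The lattice `ρ(L)` need not be normalized by `Γ`, so this commutation uses the
larger group of all translations preserving the 1-skeleton (`sum_orbits_comp`).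

For the existence of a crystal structure, `Γ` must contain a full lattice of translations. Up to `Γ`
only finitely many pairs of mirrors meet, so mirror angles have a gap at zero, and an element whose
linear part is nearly the identity is a translation (`exists_small`). Compactness of the linear
parts then yields translations in every direction. -/

namespace Geometry.SimplicialComplex

variable {d : ℕ} {K : SimplicialComplex ℝ (EuclideanSpace ℝ (Fin d))}

/-! ### Triangulations: chambers, connectedness, local finiteness -/

theorem isCompact_hull (s : Finset (EuclideanSpace ℝ (Fin d))) :
    IsCompact (convexHull ℝ (s : Set (EuclideanSpace ℝ (Fin d)))) :=
  s.finite_toSet.isCompact_convexHull ℝ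

theorem affineSpan_chamber {s : Finset (EuclideanSpace ℝ (Fin d))} (hs : s ∈ K.chambers) :
    affineSpan ℝ (s : Set (EuclideanSpace ℝ (Fin d))) = ⊤ := by
  have h := (K.indep hs.1).affineSpan_eq_top_iff_card_eq_finrank_add_one
  rw [Subtype.range_coe_subtype] at h
  exact h.2 (by simpa using hs.2)

theorem vectorSpan_chamber {s : Finset (EuclideanSpace ℝ (Fin d))} (hs : s ∈ K.chambers) :
    vectorSpan ℝ (s : Set (EuclideanSpace ℝ (Fin d))) = ⊤ := by
  rw [← direction_affineSpan, affineSpan_chamber hs, AffineSubspace.direction_top]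

theorem affineSpan_ne_top {s : Finset (EuclideanSpace ℝ (Fin d))} (hs : s ∈ K.faces)
    (h : s ∉ K.chambers) : affineSpan ℝ (s : Set (EuclideanSpace ℝ (Fin d))) ≠ ⊤ := by
  intro ht
  have h' := (K.indep hs).affineSpan_eq_top_iff_card_eq_finrank_add_one
  rw [Subtype.range_coe_subtype] at h'
  exact h ⟨hs, by simpa using h'.1 ht⟩

/-- A triangulation of `ℝᵈ` is covered by its `d`-dimensional simplices. -/
theorem IsTriangulation.exists_chamber (hK : K.IsTriangulation) (p : EuclideanSpace ℝ (Fin d)) :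
    ∃ s ∈ K.chambers, p ∈ convexHull ℝ (s : Set (EuclideanSpace ℝ (Fin d))) := by
  obtain ⟨hsp, hlf⟩ := hK
  have hne : ∀ s : K.faces,
      (convexHull ℝ (s.1 : Set (EuclideanSpace ℝ (Fin d)))).Nonempty := fun s =>
    convexHull_nonempty_iff.2 (K.nonempty_of_mem_faces s.2)
  have hcount : Countable K.faces :=
    Set.countable_univ_iff.1 (hlf.countable_univ hne)
  set A : Set (EuclideanSpace ℝ (Fin d)) :=
    ⋃ s : {s : K.faces // s.1 ∈ K.chambers},
      convexHull ℝ (s.1.1 : Set (EuclideanSpace ℝ (Fin d))) with hA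
  have hAc : IsClosed A :=
    (hlf.comp_injective Subtype.val_injective).isClosed_iUnion
      fun s => (isCompact_hull s.1.1).isClosed
  -- The lower-dimensional simplices are countably many null sets, so the open complement of the
  -- chambers is null, hence empty.
  have hnull : MeasureTheory.volume Aᶜ = 0 := by
    have hsub : Aᶜ ⊆ ⋃ s : {s : K.faces // s.1 ∉ K.chambers},
        (affineSpan ℝ (s.1.1 : Set (EuclideanSpace ℝ (Fin d))) :
          Set (EuclideanSpace ℝ (Fin d))) := by
      intro x hx
      have hx' : x ∈ K.space := by rw [hsp]; trivial
      obtain ⟨s, hs, hxs⟩ := mem_space_iff.1 hx'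
      have hsc : s ∉ K.chambers := fun h => hx (Set.mem_iUnion.2 ⟨⟨⟨s, hs⟩, h⟩, hxs⟩)
      exact Set.mem_iUnion.2 ⟨⟨⟨s, hs⟩, hsc⟩, convexHull_subset_affineSpan _ hxs⟩
    refine MeasureTheory.measure_mono_null hsub (MeasureTheory.measure_iUnion_null fun s => ?_)
    exact MeasureTheory.Measure.addHaar_affineSubspace _ _ (affineSpan_ne_top s.1.2 s.2)
  have hempty : Aᶜ = ∅ := (hAc.isOpen_compl.measure_eq_zero_iff _).1 hnull
  have hp : p ∈ A := by
    by_contra h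
    exact (Set.eq_empty_iff_forall_notMem.1 hempty) p h
  obtain ⟨s, hs⟩ := Set.mem_iUnion.1 hp
  exact ⟨s.1.1, s.2, hs⟩

/-- The simplices `s` and `{x}` meet in the hull of their common vertices. -/
theorem mem_of_mem_hull {x : EuclideanSpace ℝ (Fin d)} (hx : x ∈ K.vertices)
    {s : Finset (EuclideanSpace ℝ (Fin d))} (hs : s ∈ K.faces)
    (h : x ∈ convexHull ℝ (s : Set (EuclideanSpace ℝ (Fin d)))) : x ∈ s := by
  have h1 := K.inter_subset_convexHull hs (mem_vertices.1 hx) ⟨h, by simp⟩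
  obtain ⟨y, hy⟩ := convexHull_nonempty_iff.1 ⟨x, h1⟩
  simp only [Finset.coe_singleton, Set.mem_inter_iff, Set.mem_singleton_iff,
    SetLike.mem_coe] at hy
  exact hy.2 ▸ hy.1

theorem mem_vertices_of_mem {x : EuclideanSpace ℝ (Fin d)}
    {s : Finset (EuclideanSpace ℝ (Fin d))} (hs : s ∈ K.faces) (hx : x ∈ s) :
    x ∈ K.vertices :=
  mem_vertices.2 (K.down_closed hs (Finset.singleton_subset_iff.2 hx) (by simp))

theorem adj_of_mem {x y : K.vertices} {s : Finset (EuclideanSpace ℝ (Fin d))} (hs : s ∈ K.faces)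
    (hx : x.1 ∈ s) (hy : y.1 ∈ s) (hxy : x ≠ y) : K.oneSkeleton.Adj x y := by
  classical
  refine ⟨hxy, {x.1, y.1}, K.down_closed hs ?_ (by simp), by simp⟩
  intro z hz
  simp only [Finset.mem_insert, Finset.mem_singleton] at hz
  rcases hz with rfl | rfl <;> assumption

/-- The 1-skeleton of a triangulation of `ℝᵈ` is connected. -/
theorem IsTriangulation.connected (hK : K.IsTriangulation) :
    K.oneSkeleton.toDirGraph.Connected := by
  classical
  have hv : Nonempty K.vertices := by
    obtain ⟨s, hs, -⟩ := hK.exists_chamber 0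
    obtain ⟨x, hx⟩ := K.nonempty_of_mem_faces hs.1
    exact ⟨⟨x, mem_vertices_of_mem hs.1 hx⟩⟩
  refine ⟨hv, fun x y => ?_⟩
  obtain ⟨hsp, hlf⟩ := hK
  set R : K.vertices → K.vertices → Prop :=
    Relation.ReflTransGen
      (fun a b => ∃ e, K.oneSkeleton.toDirGraph.o e = a ∧ K.oneSkeleton.toDirGraph.t e = b) with hR
  have hadj : ∀ s ∈ K.faces, ∀ a b : K.vertices, a.1 ∈ s → b.1 ∈ s → R x a → R x b := by
    intro s hs a b ha hb hxa
    by_cases hab : a = b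
    · exact hab ▸ hxa
    · exact hxa.tail ⟨⟨(a, b), adj_of_mem hs ha hb hab⟩, rfl, rfl⟩
  let P : K.faces → Prop := fun s => ∃ a : K.vertices, a.1 ∈ s.1 ∧ R x a
  let U : Set (EuclideanSpace ℝ (Fin d)) :=
    ⋃ s : {s // P s}, convexHull ℝ (s.1.1 : Set (EuclideanSpace ℝ (Fin d)))
  let W : Set (EuclideanSpace ℝ (Fin d)) :=
    ⋃ s : {s // ¬ P s}, convexHull ℝ (s.1.1 : Set (EuclideanSpace ℝ (Fin d)))
  have hU : IsClosed U := (hlf.comp_injective Subtype.val_injective).isClosed_iUnion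
      fun s => (isCompact_hull s.1.1).isClosed
  have hW : IsClosed W := (hlf.comp_injective Subtype.val_injective).isClosed_iUnion
      fun s => (isCompact_hull s.1.1).isClosed
  -- Simplices with a common point have a common vertex, so reachability passes from one to the
  -- other. The reachable and unreachable simplices thus cover complementary closed sets.
  have hUW : Uᶜ = W := by
    apply Set.Subset.antisymm
    · intro p hp
      have hp' : p ∈ K.space := by rw [hsp]; trivial
      obtain ⟨s, hs, hps⟩ := mem_space_iff.1 hp'
      refine Set.mem_iUnion.2 ⟨⟨⟨s, hs⟩, fun h => hp ?_⟩, hps⟩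
      exact Set.mem_iUnion.2 ⟨⟨⟨s, hs⟩, h⟩, hps⟩
    · intro p hp hpU
      obtain ⟨⟨⟨s, hs⟩, hsP⟩, hps⟩ := Set.mem_iUnion.1 hp
      obtain ⟨⟨⟨t, ht⟩, a, hat, hxa⟩, hpt⟩ := Set.mem_iUnion.1 hpU
      obtain ⟨z, hz⟩ := convexHull_nonempty_iff.1 ⟨p, K.inter_subset_convexHull hs ht ⟨hps, hpt⟩⟩
      refine hsP ⟨⟨z, mem_vertices_of_mem hs hz.1⟩, hz.1, ?_⟩
      exact hadj t ht a _ hat hz.2 hxa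
  have hclopen : IsClopen U := ⟨hU, by rw [← compl_compl U, hUW]; exact hW.isOpen_compl⟩
  have hxU : x.1 ∈ U := Set.mem_iUnion.2 ⟨⟨⟨{x.1}, mem_vertices.1 x.2⟩, x, by simp, .refl⟩, by simp⟩
  have huniv : U = Set.univ := hclopen.eq_univ ⟨_, hxU⟩
  have hyU : y.1 ∈ U := by rw [huniv]; trivial
  obtain ⟨⟨⟨t, ht⟩, a, hat, hxa⟩, hyt⟩ := Set.mem_iUnion.1 hyU
  exact hadj t ht a y hat (mem_of_mem_hull y.2 ht hyt) hxa

/-- A compact set meets only finitely many simplices of a triangulation. -/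
theorem IsTriangulation.finite_faces (hK : K.IsTriangulation) {A : Set (EuclideanSpace ℝ (Fin d))}
    (hA : IsCompact A) :
    {s | s ∈ K.faces ∧ (convexHull ℝ (s : Set (EuclideanSpace ℝ (Fin d))) ∩ A).Nonempty}.Finite := by
  refine ((hK.2.finite_nonempty_inter_compact hA).image Subtype.val).subset ?_
  rintro s ⟨hs, h⟩
  exact ⟨⟨s, hs⟩, h, rfl⟩

theorem IsTriangulation.finite_vertices (hK : K.IsTriangulation)
    {A : Set (EuclideanSpace ℝ (Fin d))} (hA : IsCompact A) : (K.vertices ∩ A).Finite := by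
  refine Set.Finite.of_finite_image ((hK.finite_faces hA).subset ?_)
    (f := fun x => ({x} : Finset _)) Finset.singleton_injective.injOn
  rintro _ ⟨x, ⟨hx, hxA⟩, rfl⟩
  exact ⟨mem_vertices.1 hx, x, by simp, hxA⟩

/-! ### Facet normals of a chamber -/

/-- In every facet of a chamber there is a reflection of `Γ`, given by a unit normal. -/
theorem exists_facet_reflection (hd : 1 ≤ d) {s : Finset (EuclideanSpace ℝ (Fin d))}
    (hs : s ∈ K.chambers) {y : EuclideanSpace ℝ (Fin d)} (hy : y ∈ s) :
    ∃ r ∈ K.reflectionGroup, ∃ n p : EuclideanSpace ℝ (Fin d), ‖n‖ = 1 ∧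
      (∀ x, r x = x - (2 * inner ℝ n (x - p)) • n) ∧
      ∀ x ∈ s, x ≠ y → inner ℝ n (x - p) = 0 := by
  classical
  set t := s.erase y with ht
  have htc : t.card = d := by rw [Finset.card_erase_of_mem hy, hs.2]; rfl
  have htne : t.Nonempty := Finset.card_pos.1 (by omega)
  obtain ⟨p, hp⟩ := htne
  set H := affineSpan ℝ (t : Set (EuclideanSpace ℝ (Fin d))) with hH
  have hpH : p ∈ H := subset_affineSpan _ _ hp
  have : Nonempty H := ⟨⟨p, hpH⟩⟩
  have hdim : Module.finrank ℝ H.direction = d - 1 := by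
    have hind : AffineIndependent ℝ (fun x : t => (x : EuclideanSpace ℝ (Fin d))) :=
      (K.indep hs.1).mono (Finset.coe_subset.2 (Finset.erase_subset y s))
    have := hind.finrank_vectorSpan (n := d - 1) (by simp only [Fintype.card_coe]; omega)
    rw [Subtype.range_coe_subtype] at this
    rw [hH, direction_affineSpan]
    exact this
  have hdim' : Module.finrank ℝ H.directionᗮ = 1 := by
    have h := H.direction.finrank_add_finrank_orthogonal
    rw [hdim, finrank_euclideanSpace_fin] at h
    omega
  obtain ⟨⟨m, hm⟩, hm0, hmspan⟩ := finrank_eq_one_iff'.1 hdim'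
  have hm0' : m ≠ 0 := fun h => hm0 (Subtype.ext h)
  set n := ‖m‖⁻¹ • m with hn
  have hn1 : ‖n‖ = 1 := by
    rw [hn, norm_smul, norm_inv, norm_norm, inv_mul_cancel₀ (norm_ne_zero_iff.2 hm0')]
  have hnmem : n ∈ H.directionᗮ := Submodule.smul_mem _ _ hm
  have hspan : ∀ w ∈ H.directionᗮ, ∃ c : ℝ, w = c • n := by
    intro w hw
    obtain ⟨c, hc⟩ := hmspan ⟨w, hw⟩
    refine ⟨c * ‖m‖, ?_⟩
    rw [hn, smul_smul, mul_assoc, mul_inv_cancel₀ (norm_ne_zero_iff.2 hm0'), mul_one]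
    exact (congrArg Subtype.val hc).symm
  refine ⟨EuclideanGeometry.reflection H, Subgroup.subset_closure
    ⟨s, hs, t, Finset.erase_subset y s, htc, inferInstance, rfl⟩, n, p, hn1, fun x => ?_,
    fun x hx hxy => ?_⟩
  · set a := inner ℝ n (x - p) with ha
    have hq : x - a • n ∈ H := by
      have hdir : x - a • n - p ∈ H.direction := by
        rw [← Submodule.orthogonal_orthogonal H.direction]
        intro w hw
        obtain ⟨c, rfl⟩ := hspan w hw
        rw [show x - a • n - p = (x - p) - a • n by abel, inner_smul_left, inner_sub_right,
          inner_smul_right, real_inner_self_eq_norm_sq, hn1, ← ha]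
        simp
      have := AffineSubspace.vadd_mem_of_mem_direction hdir hpH
      simpa using this
    have h := EuclideanGeometry.reflection_orthogonal_vadd hq
      (Submodule.smul_mem H.directionᗮ a hnmem)
    simp only [vadd_eq_add] at h
    rw [show a • n + (x - a • n) = x by abel] at h
    rw [h, mul_smul, two_smul]
    abel
  · rw [real_inner_comm]
    refine hnmem _ ?_
    exact AffineSubspace.vsub_mem_direction
      (subset_affineSpan _ _ (by simp [ht, hx, hxy])) hpH

/-- The differences of the vertices of a chamber span the whole space. -/
theorem eq_zero_of_inner_chamber {s : Finset (EuclideanSpace ℝ (Fin d))} (hs : s ∈ K.chambers)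
    {v : EuclideanSpace ℝ (Fin d)} (h : ∀ x ∈ s, ∀ y ∈ s, inner ℝ v (x - y) = 0) : v = 0 := by
  have hv : v ∈ (vectorSpan ℝ (s : Set (EuclideanSpace ℝ (Fin d))))ᗮ := by
    rw [vectorSpan_def, Submodule.mem_orthogonal']
    intro u hu
    induction hu using Submodule.span_induction with
    | mem u hu =>
      obtain ⟨x, hx, y, hy, rfl⟩ := hu
      exact h x hx y hy
    | zero => simp
    | add a b _ _ ha hb => rw [inner_add_right, ha, hb, add_zero]
    | smul c a _ ha => rw [inner_smul_right, ha, mul_zero]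
  rw [vectorSpan_chamber hs] at hv
  simpa using hv

/-- The facet reflections of a chamber `s` are the reflections in hyperplanes with unit normals
`n y` for which `c y • n y` are the gradients of the barycentric coordinates. -/
theorem exists_gradients (hd : 1 ≤ d) {s : Finset (EuclideanSpace ℝ (Fin d))}
    (hs : s ∈ K.chambers) :
    ∃ (r : EuclideanSpace ℝ (Fin d) → EuclideanSpace ℝ (Fin d) ≃ᵃⁱ[ℝ] EuclideanSpace ℝ (Fin d))
      (n p : EuclideanSpace ℝ (Fin d) → EuclideanSpace ℝ (Fin d))
      (c : EuclideanSpace ℝ (Fin d) → ℝ), (∀ y ∈ s, r y ∈ K.reflectionGroup ∧ ‖n y‖ = 1 ∧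
        c y ≠ 0 ∧
        (∀ x, r y x = x - (2 * inner ℝ (n y) (x - p y)) • n y) ∧
        (∀ x ∈ s, x ≠ y → inner ℝ (n y) (x - p y) = 0)) ∧
        (∑ y ∈ s, c y • n y = 0) ∧
        (∀ y ∈ s, ∀ x ∈ s, ∀ a : EuclideanSpace ℝ (Fin d) → ℝ,
          inner ℝ (∑ z ∈ s, (a z * c z) • n z) (y - x) = a y - a x) ∧
        Submodule.span ℝ (n '' (s : Set (EuclideanSpace ℝ (Fin d)))) = ⊤ := by
  classical
  have H : ∀ y, ∃ (r : EuclideanSpace ℝ (Fin d) ≃ᵃⁱ[ℝ] EuclideanSpace ℝ (Fin d))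
      (n p : EuclideanSpace ℝ (Fin d)), y ∈ s → r ∈ K.reflectionGroup ∧ ‖n‖ = 1 ∧
      (∀ x, r x = x - (2 * inner ℝ n (x - p)) • n) ∧
      ∀ x ∈ s, x ≠ y → inner ℝ n (x - p) = 0 := by
    intro y
    by_cases hy : y ∈ s
    · obtain ⟨r, hr, n, p, h⟩ := exists_facet_reflection hd hs hy
      exact ⟨r, n, p, fun _ => ⟨hr, h⟩⟩
    · exact ⟨1, 0, 0, fun h => absurd h hy⟩
  choose r n p h using H
  have hne : ∀ y ∈ s, inner ℝ (n y) (y - p y) ≠ 0 := by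
    intro y hy h0
    have hz : n y = 0 := by
      refine eq_zero_of_inner_chamber hs fun x hx x' hx' => ?_
      have key : ∀ x ∈ s, inner ℝ (n y) (x - p y) = 0 := fun x hx => by
        by_cases hxy : x = y
        · rw [hxy, h0]
        · exact (h y hy).2.2.2 x hx hxy
      rw [show x - x' = (x - p y) - (x' - p y) by abel, inner_sub_right, key x hx, key x' hx',
        sub_zero]
    have := (h y hy).2.1
    rw [hz] at this
    simp at this
  -- With this scaling, `c z * ⟨n z, x - p z⟩` is the barycentric coordinate of `x` at the vertex
  -- `z`.
  set c : EuclideanSpace ℝ (Fin d) → ℝ := fun y => (inner ℝ (n y) (y - p y))⁻¹ with hc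
  have hdelta : ∀ y ∈ s, ∀ x ∈ s, ∀ a : EuclideanSpace ℝ (Fin d) → ℝ,
      inner ℝ (∑ z ∈ s, (a z * c z) • n z) (y - x) = a y - a x := by
    intro y hy x hx a
    have hterm : ∀ z ∈ s, ∀ w ∈ s, (a z * c z) * inner ℝ (n z) (w - p z) =
        if z = w then a z else 0 := by
      intro z hz w hw
      split_ifs with hzw
      · subst hzw
        rw [mul_assoc, inv_mul_cancel₀ (hne z hz), mul_one]
      · rw [(h z hz).2.2.2 w hw (Ne.symm hzw), mul_zero]
    have hsum : ∀ w ∈ s, ∑ z ∈ s, (a z * c z) * inner ℝ (n z) (w - p z) = a w := by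
      intro w hw
      rw [Finset.sum_congr rfl fun z hz => hterm z hz w hw]
      simp [hw]
    rw [sum_inner, ← hsum y hy, ← hsum x hx, ← Finset.sum_sub_distrib]
    refine Finset.sum_congr rfl fun z _ => ?_
    rw [real_inner_smul_left, ← mul_sub, ← inner_sub_right]
    congr 2
    abel
  refine ⟨r, n, p, c, fun y hy =>
    ⟨(h y hy).1, (h y hy).2.1, inv_ne_zero (hne y hy), (h y hy).2.2.1, (h y hy).2.2.2⟩, ?_,
    hdelta, ?_⟩
  -- The barycentric coordinates sum to a constant, so their gradients sum to zero.
  · refine eq_zero_of_inner_chamber hs fun y hy x hx => ?_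
    simpa using hdelta y hy x hx (fun _ => 1)
  · rw [← Submodule.orthogonal_eq_bot_iff, Submodule.eq_bot_iff]
    intro w hw
    have hw' : ∀ y ∈ s, inner ℝ (n y) w = 0 := fun y hy =>
      hw _ (Submodule.subset_span ⟨y, hy, rfl⟩)
    obtain ⟨y₀, hy₀⟩ := K.nonempty_of_mem_faces hs.1
    -- Expansion of `v` in the edges at `y₀`, with the derivatives of the barycentric coordinates as
    -- coefficients: a vector orthogonal to every normal vanishes.
    have hrep : ∀ v ∈ vectorSpan ℝ (s : Set (EuclideanSpace ℝ (Fin d))),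
        v = ∑ z ∈ s, (c z * inner ℝ (n z) v) • (z - y₀) := by
      intro v hv
      rw [vectorSpan_eq_span_vsub_set_right ℝ (Finset.mem_coe.2 hy₀)] at hv
      induction hv using Submodule.span_induction with
      | mem u hu =>
        obtain ⟨y, hy, rfl⟩ := hu
        simp only [vsub_eq_sub]
        have hz : ∀ z ∈ s, (c z * inner ℝ (n z) (y - y₀)) • (z - y₀) =
            if z = y then y - y₀ else 0 := by
          intro z hz
          have := hdelta y hy y₀ hy₀ (fun x => if x = z then 1 else 0)
          simp only [ite_mul, one_mul, zero_mul, ite_smul, zero_smul, Finset.sum_ite_eq', hz,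
            if_true, real_inner_smul_left] at this
          rw [this]
          by_cases h2 : z = y₀
          · subst h2
            by_cases h3 : z = y
            · subst h3; simp
            · simp [h3]
          · by_cases h1 : z = y
            · subst h1; simp [Ne.symm h2]
            · simp [h1, Ne.symm h1, Ne.symm h2]
        rw [Finset.sum_congr rfl hz]
        simp [Finset.mem_coe.1 hy]
      | zero => simp
      | add a b _ _ ha hb =>
        conv_lhs => rw [ha, hb]
        rw [← Finset.sum_add_distrib]
        refine Finset.sum_congr rfl fun z _ => ?_
        rw [inner_add_right, mul_add, add_smul]
      | smul t a _ ha =>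
        conv_lhs => rw [ha]
        rw [Finset.smul_sum]
        refine Finset.sum_congr rfl fun z _ => ?_
        rw [inner_smul_right, smul_smul]
        congr 1
        ring
    rw [hrep w (by rw [vectorSpan_chamber hs]; trivial)]
    exact Finset.sum_eq_zero fun z hz => by rw [hw' z hz, mul_zero, zero_smul]

/-- The linear part of an isometry given by a formula for a reflection. -/
theorem linear_reflection {r : EuclideanSpace ℝ (Fin d) ≃ᵃⁱ[ℝ] EuclideanSpace ℝ (Fin d)}
    {n p : EuclideanSpace ℝ (Fin d)} (h : ∀ x, r x = x - (2 * inner ℝ n (x - p)) • n)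
    (v : EuclideanSpace ℝ (Fin d)) :
    r.linearIsometryEquiv v = v - (2 * inner ℝ n v) • n := by
  have h1 := r.map_vadd p v
  simp only [vadd_eq_add] at h1
  rw [h, h] at h1
  simp only [add_sub_cancel_right, sub_self, inner_zero_right, mul_zero, zero_smul, sub_zero] at h1
  have h2 := eq_sub_of_add_eq h1.symm
  rw [h2]; abel

/-- A linear map commuting with the linear parts of all reflections in `Γ` is a scalar. -/
theorem exists_scalar (hd : 1 ≤ d) {s : Finset (EuclideanSpace ℝ (Fin d))} (hs : s ∈ K.chambers)
    (A : EuclideanSpace ℝ (Fin d) →ₗ[ℝ] EuclideanSpace ℝ (Fin d))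
    (hA : ∀ r ∈ K.reflectionGroup,
      ∀ v, A (r.linearIsometryEquiv v) = r.linearIsometryEquiv (A v)) :
    ∃ c : ℝ, ∀ v, A v = c • v := by
  classical
  obtain ⟨r, n, p, c, h, h0, hdelta, hspan⟩ := exists_gradients hd hs
  let μ : EuclideanSpace ℝ (Fin d) → ℝ := fun y => inner ℝ (n y) (A (n y))
  -- `A` preserves the `-1`-eigenspace of each reflection, which is the line through `n y`.
  have hμ : ∀ y ∈ s, A (n y) = μ y • n y := by
    intro y hy
    obtain ⟨hr, hn, -, hf, -⟩ := h y hy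
    have h1 := hA (r y) hr (n y)
    rw [linear_reflection hf, linear_reflection hf, map_sub, map_smul,
      real_inner_self_eq_norm_sq, hn] at h1
    have h2 : (2 : ℝ) • A (n y) = (2 : ℝ) • (μ y • n y) := by
      rw [smul_smul]
      have := sub_right_injective h1
      simpa using this
    exact smul_right_injective _ (two_ne_zero) h2
  have hsum : ∑ y ∈ s, (μ y * c y) • n y = 0 := by
    have := congrArg A h0
    rw [map_sum, map_zero] at this
    rw [← this]
    refine Finset.sum_congr rfl fun y hy => ?_
    rw [map_smul, hμ y hy, smul_smul, mul_comm]
  obtain ⟨y₀, hy₀⟩ := K.nonempty_of_mem_faces hs.1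
  -- Applying `A` to the relation among the normals gives a second relation; pairing it with `y -
  -- y₀` compares the eigenvalues.
  have hconst : ∀ y ∈ s, μ y = μ y₀ := by
    intro y hy
    have := hdelta y hy y₀ hy₀ μ
    rw [hsum, inner_zero_left] at this
    linarith
  refine ⟨μ y₀, fun v => ?_⟩
  have hv : v ∈ Submodule.span ℝ (n '' (s : Set (EuclideanSpace ℝ (Fin d)))) := by
    rw [hspan]; trivial
  induction hv using Submodule.span_induction with
  | mem u hu =>
    obtain ⟨y, hy, rfl⟩ := hu
    rw [hμ y hy, hconst y hy]
  | zero => simp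
  | add a b _ _ ha hb => rw [map_add, ha, hb, smul_add]
  | smul t a _ ha => rw [map_smul, ha, smul_comm]

/-- A vector which is fixed by the linear parts of the elements of `Γ` fixing a given vertex is
zero. -/
theorem eq_zero_of_fixed (hd : 1 ≤ d) {s : Finset (EuclideanSpace ℝ (Fin d))}
    (hs : s ∈ K.chambers) {x : EuclideanSpace ℝ (Fin d)} (hx : x ∈ s)
    {F : EuclideanSpace ℝ (Fin d)}
    (hF : ∀ r ∈ K.reflectionGroup, r x = x → r.linearIsometryEquiv F = F) : F = 0 := by
  obtain ⟨r, n, p, c, h, h0, -, hspan⟩ := exists_gradients hd hs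
  -- The facet opposite to `y ≠ x` contains `x`, so its reflection fixes `x`.
  have h1 : ∀ y ∈ s, y ≠ x → inner ℝ (n y) F = 0 := by
    intro y hy hyx
    obtain ⟨hr, hn, -, hf, hz⟩ := h y hy
    have hfix : r y x = x := by rw [hf, hz x hx (Ne.symm hyx)]; simp
    have h2 := hF (r y) hr hfix
    rw [linear_reflection hf, sub_eq_self, smul_eq_zero] at h2
    have hn0 : n y ≠ 0 := fun h => by simp [h] at hn
    simpa [hn0] using h2
  have h2 : ∀ y ∈ s, inner ℝ (n y) F = 0 := by
    intro y hy
    by_cases hyx : y = x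
    · subst hyx
      -- The normal opposite to `x` is reached through the relation, where its coefficient is
      -- nonzero.
      have h3 := congrArg (fun v => inner ℝ v F) h0
      simp only [sum_inner, inner_zero_left, real_inner_smul_left] at h3
      rw [Finset.sum_eq_single y (fun z hz hzy => by rw [h1 z hz hzy, mul_zero])
        (fun h => absurd hy h)] at h3
      exact (mul_eq_zero.1 h3).resolve_left (h y hy).2.2.1
    · exact h1 y hy hyx
  have hF' : F ∈ (Submodule.span ℝ (n '' (s : Set (EuclideanSpace ℝ (Fin d)))))ᗮ := by
    rw [Submodule.mem_orthogonal]
    intro u hu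
    induction hu using Submodule.span_induction with
    | mem u hu =>
      obtain ⟨y, hy, rfl⟩ := hu
      exact h2 y hy
    | zero => simp
    | add a b _ _ ha hb => rw [inner_add_left, ha, hb, add_zero]
    | smul t a _ ha => rw [real_inner_smul_left, ha, mul_zero]
  rw [hspan] at hF'
  simpa using hF'

end Geometry.SimplicialComplex

/-! ### Proper discontinuity and the translations in the reflection group -/

namespace Geometry.SimplicialComplex

variable {d : ℕ} {K : SimplicialComplex ℝ (EuclideanSpace ℝ (Fin d))}

theorem image_hull (g : EuclideanSpace ℝ (Fin d) ≃ᵃⁱ[ℝ] EuclideanSpace ℝ (Fin d))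
    (s : Finset (EuclideanSpace ℝ (Fin d))) {x : EuclideanSpace ℝ (Fin d)}
    (hx : x ∈ convexHull ℝ (s : Set (EuclideanSpace ℝ (Fin d)))) :
    g x ∈ convexHull ℝ (s.map g.toEquiv.toEmbedding : Set (EuclideanSpace ℝ (Fin d))) := by
  have h := AffineMap.image_convexHull (𝕜 := ℝ) g.toAffineEquiv.toAffineMap
    (s : Set (EuclideanSpace ℝ (Fin d)))
  rw [Finset.coe_map]
  exact h ▸ ⟨x, hx, rfl⟩

/-- The action of `Γ` on `ℝᵈ` is properly discontinuous. -/
theorem IsCoxeterComplex.finite_return (hK : K.IsCoxeterComplex)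
    {s : Finset (EuclideanSpace ℝ (Fin d))} (hs : s ∈ K.chambers) :
    {g | g ∈ K.reflectionGroup ∧ ∃ x ∈ convexHull ℝ (s : Set (EuclideanSpace ℝ (Fin d))),
      g x ∈ convexHull ℝ (s : Set (EuclideanSpace ℝ (Fin d)))}.Finite := by
  classical
  have hfin := hK.isTriangulation.finite_faces (isCompact_hull s)
  set F := {t | t ∈ K.faces ∧ (convexHull ℝ (t : Set (EuclideanSpace ℝ (Fin d))) ∩
    convexHull ℝ (s : Set (EuclideanSpace ℝ (Fin d)))).Nonempty} with hF
  have hU : (⋃ t ∈ F, (t : Set (EuclideanSpace ℝ (Fin d)))).Finite :=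
    hfin.biUnion fun t _ => t.finite_toSet
  have hpi : {f : s → EuclideanSpace ℝ (Fin d) |
      ∀ i, f i ∈ ⋃ t ∈ F, (t : Set (EuclideanSpace ℝ (Fin d)))}.Finite :=
    Set.Finite.pi' fun _ => hU
  -- An isometry is determined by the images of the vertices of `s`, which here lie in the finite
  -- set of vertices of simplices meeting `s`.
  refine Set.Finite.of_finite_image (f := fun g (y : s) => g y.1) (hpi.subset ?_) ?_
  · rintro _ ⟨g, ⟨hg, x, hx, hgx⟩, rfl⟩ y
    refine Set.mem_biUnion (x := s.map g.toEquiv.toEmbedding)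
      ⟨hK.preserves g hg s hs.1, g x, image_hull g s hx, hgx⟩ ?_
    rw [Finset.coe_map]
    exact ⟨y, y.2, rfl⟩
  · intro g _ g' _ h
    have h1 : g.toAffineEquiv.toAffineMap = g'.toAffineEquiv.toAffineMap :=
      AffineMap.ext_on (affineSpan_chamber hs) fun y hy => congrFun h ⟨y, hy⟩
    exact AffineIsometryEquiv.ext fun x => DFunLike.congr_fun h1 x

theorem IsCoxeterComplex.exists_mem_hull (hK : K.IsCoxeterComplex)
    {s : Finset (EuclideanSpace ℝ (Fin d))} (hs : s ∈ K.chambers)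
    (p : EuclideanSpace ℝ (Fin d)) : ∃ g ∈ K.reflectionGroup,
      g p ∈ convexHull ℝ (s : Set (EuclideanSpace ℝ (Fin d))) := by
  obtain ⟨t, ht, hp⟩ := hK.isTriangulation.exists_chamber p
  obtain ⟨g, hg, hgt⟩ := hK.transitive t ht s hs
  exact ⟨g, hg, hgt ▸ image_hull g t hp⟩

/-- Conjugation by `g` moves the mirror by `g` and its normal by the linear part of `g`. -/
theorem conj_reflection {r : EuclideanSpace ℝ (Fin d) ≃ᵃⁱ[ℝ] EuclideanSpace ℝ (Fin d)}
    {n p : EuclideanSpace ℝ (Fin d)} (h : ∀ x, r x = x - (2 * inner ℝ n (x - p)) • n)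
    (g : EuclideanSpace ℝ (Fin d) ≃ᵃⁱ[ℝ] EuclideanSpace ℝ (Fin d))
    (x : EuclideanSpace ℝ (Fin d)) :
    (g * r * g⁻¹) x =
      x - (2 * inner ℝ (g.linearIsometryEquiv n) (x - g p)) • g.linearIsometryEquiv n := by
  obtain ⟨y, rfl⟩ := g.surjective x
  have h1 : (g * r * g⁻¹) (g y) = g (r y) := by
    change g (r (g⁻¹ (g y))) = _
    congr 2
    exact g.symm_apply_apply y
  have h2 : g y - g p = g.linearIsometryEquiv (y - p) := (g.map_vsub y p).symm
  have h3 := g.map_vsub (r y) y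
  rw [h1, h2, LinearIsometryEquiv.inner_map_map]
  simp only [vsub_eq_sub] at h3
  rw [eq_comm, sub_eq_iff_eq_add, h] at h3
  rw [h, h3, sub_right_comm, sub_self, zero_sub, map_neg, map_smul]
  abel

/-- Two hyperplanes meet or are parallel. -/
theorem meet_or_parallel {n n' p p' : EuclideanSpace ℝ (Fin d)} (hn : ‖n‖ = 1) (hn' : ‖n'‖ = 1) :
    (∃ x, inner ℝ n (x - p) = 0 ∧ inner ℝ n' (x - p') = 0) ∨ (inner ℝ n n') ^ 2 = 1 := by
  by_cases hq : (inner ℝ n n') ^ 2 = 1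
  · exact Or.inr hq
  refine Or.inl ?_
  have hne : 1 - (inner ℝ n n') ^ 2 ≠ 0 := fun h => hq (by linarith)
  have h1 : inner ℝ n (n' - (inner ℝ n n') • n) = 0 := by
    rw [inner_sub_right, inner_smul_right, real_inner_self_eq_norm_sq, hn]
    ring
  have h2 : inner ℝ n' (n' - (inner ℝ n n') • n) = 1 - (inner ℝ n n') ^ 2 := by
    rw [inner_sub_right, inner_smul_right, real_inner_self_eq_norm_sq, hn', real_inner_comm n n']
    ring
  -- From `p`, move inside the first hyperplane along the part of `n'` orthogonal to `n` until the
  -- second one is reached.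
  refine ⟨p + (-(inner ℝ n' (p - p')) / (1 - (inner ℝ n n') ^ 2)) •
    (n' - (inner ℝ n n') • n), ?_, ?_⟩
  · rw [add_sub_cancel_left, inner_smul_right, h1, mul_zero]
  · rw [add_sub_right_comm, inner_add_right, inner_smul_right, h2, div_mul_cancel₀ _ hne,
      add_neg_cancel]

/-- The angles between the mirrors of reflections in `Γ` are bounded away from zero. -/
theorem IsCoxeterComplex.exists_gap (hK : K.IsCoxeterComplex) :
    ∃ η : ℝ, 0 < η ∧ ∀ r ∈ K.reflectionGroup, ∀ r' ∈ K.reflectionGroup,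
      ∀ n p n' p' : EuclideanSpace ℝ (Fin d), ‖n‖ = 1 → ‖n'‖ = 1 →
      (∀ x, r x = x - (2 * inner ℝ n (x - p)) • n) →
      (∀ x, r' x = x - (2 * inner ℝ n' (x - p')) • n') →
      1 - η < (inner ℝ n n') ^ 2 → (inner ℝ n n') ^ 2 = 1 := by
  obtain ⟨s, hs, -⟩ := hK.isTriangulation.exists_chamber 0
  set R := {g | g ∈ K.reflectionGroup ∧ ∃ x ∈ convexHull ℝ (s : Set (EuclideanSpace ℝ (Fin d))),
      g x ∈ convexHull ℝ (s : Set (EuclideanSpace ℝ (Fin d)))} with hR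
  have hRfin : R.Finite := hK.finite_return hs
  set I : Set ℝ := ⋃ r ∈ R, ⋃ r' ∈ R, {q | ∃ n p n' p' : EuclideanSpace ℝ (Fin d),
    ‖n‖ = 1 ∧ ‖n'‖ = 1 ∧ (∀ x, r x = x - (2 * inner ℝ n (x - p)) • n) ∧
      (∀ x, r' x = x - (2 * inner ℝ n' (x - p')) • n') ∧ q = (inner ℝ n n') ^ 2} with hI
  -- A reflection determines its unit normal only up to sign; the squared cosine ignores the sign,
  -- so each pair contributes at most one value.
  have hIfin : I.Finite := by
    refine hRfin.biUnion fun r _ => hRfin.biUnion fun r' _ => Set.Subsingleton.finite ?_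
    rintro q ⟨n, p, n', p', hn, hn', h, h', rfl⟩ q' ⟨m, k, m', k', hm, hm', l, l', rfl⟩
    have e : ∀ v, inner ℝ n v • n = inner ℝ m v • m := fun v => by
      have := (linear_reflection h v).symm.trans (linear_reflection l v)
      have := sub_right_injective this
      rw [mul_smul, mul_smul] at this
      exact smul_right_injective _ (two_ne_zero) this
    have e' : ∀ v, inner ℝ n' v • n' = inner ℝ m' v • m' := fun v => by
      have := (linear_reflection h' v).symm.trans (linear_reflection l' v)
      have := sub_right_injective this
      rw [mul_smul, mul_smul] at this
      exact smul_right_injective _ (two_ne_zero) this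
    have e1 := congrArg (fun v => inner ℝ v n') (e n')
    have e2 := congrArg (fun v => inner ℝ v m) (e' m)
    simp only [real_inner_smul_left] at e1 e2
    have e3 : inner ℝ n' m = inner ℝ m n' := real_inner_comm _ _
    have e4 : inner ℝ m' m = inner ℝ m m' := real_inner_comm _ _
    rw [e3, e4] at e2
    rw [sq, sq, e1, e2]
  obtain ⟨η, hη, hball⟩ := Metric.isOpen_iff.1
    (hIfin.subset Set.sdiff_subset : (I \ {1}).Finite).isClosed.isOpen_compl 1 (by simp)
  refine ⟨η, hη, fun r hr r' hr' n p n' p' hn hn' h h' hlt => ?_⟩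
  rcases meet_or_parallel (p := p) (p' := p') hn hn' with ⟨x, hx, hx'⟩ | hq
  -- A common point of the mirrors can be moved into `s`; both conjugated reflections fix it, so
  -- they belong to the finite set `R`.
  · obtain ⟨g, hg, hgx⟩ := hK.exists_mem_hull hs x
    have hmem : ∀ r ∈ K.reflectionGroup, r x = x → g * r * g⁻¹ ∈ R := fun r hr hrx => by
      refine ⟨mul_mem (mul_mem hg hr) (inv_mem hg), g x, hgx, ?_⟩
      have : (g * r * g⁻¹) (g x) = g (r x) := by
        change g (r (g⁻¹ (g x))) = _
        congr 2
        exact g.symm_apply_apply x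
      rw [this, hrx]
      exact hgx
    have hqI : (inner ℝ n n') ^ 2 ∈ I := by
      refine Set.mem_biUnion (hmem r hr (by rw [h, hx]; simp))
        (Set.mem_biUnion (hmem r' hr' (by rw [h', hx']; simp)) ?_)
      refine ⟨g.linearIsometryEquiv n, g p, g.linearIsometryEquiv n', g p', ?_, ?_,
        conj_reflection h g, conj_reflection h' g, ?_⟩
      · rw [LinearIsometryEquiv.norm_map, hn]
      · rw [LinearIsometryEquiv.norm_map, hn']
      · rw [LinearIsometryEquiv.inner_map_map]
    by_contra hne
    have hle : (inner ℝ n n') ^ 2 ≤ 1 := by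
      have := abs_real_inner_le_norm n n'
      rw [hn, hn', one_mul] at this
      rw [← sq_abs]
      exact pow_le_one₀ (abs_nonneg _) this
    refine hball (show (inner ℝ n n') ^ 2 ∈ Metric.ball 1 η from ?_) ⟨hqI, hne⟩
    rw [Metric.mem_ball, Real.dist_eq, abs_lt]
    constructor <;> linarith
  · exact hq

/-- An element of `Γ` whose linear part is close to the identity is a translation. -/
theorem IsCoxeterComplex.exists_small (hd : 1 ≤ d) (hK : K.IsCoxeterComplex) :
    ∃ ε : ℝ, 0 < ε ∧ ∀ g ∈ K.reflectionGroup,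
      (∀ v, ‖v‖ = 1 → ‖g.linearIsometryEquiv v - v‖ < ε) →
      ∀ v, g.linearIsometryEquiv v = v := by
  obtain ⟨η, hη, hgap⟩ := hK.exists_gap
  obtain ⟨s, hs, -⟩ := hK.isTriangulation.exists_chamber 0
  obtain ⟨r, n, p, c, h, -, -, hspan⟩ := exists_gradients hd hs
  -- With `e` the displacement of a unit normal and `t` its cosine, `t = 1 - e² / 2`. The bound `e <
  -- η` puts `t²` in the gap, and `e < 1` excludes `t = -1`.
  refine ⟨min 1 η, lt_min one_pos hη, fun g hg hlt v => ?_⟩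
  have hfix : ∀ y ∈ s, g.linearIsometryEquiv (n y) = n y := by
    intro y hy
    obtain ⟨hr, hn, -, hf, -⟩ := h y hy
    have hn' : ‖g.linearIsometryEquiv (n y)‖ = 1 := by rw [LinearIsometryEquiv.norm_map, hn]
    have hsmall := hlt (n y) hn
    have hq := hgap (r y) hr (g * r y * g⁻¹) (mul_mem (mul_mem hg hr) (inv_mem hg)) (n y) (p y)
      (g.linearIsometryEquiv (n y)) (g (p y)) hn hn' hf (conj_reflection hf g)
    have hnorm := norm_sub_sq_real (g.linearIsometryEquiv (n y)) (n y)
    rw [hn, hn', real_inner_comm] at hnorm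
    set t := inner ℝ (n y) (g.linearIsometryEquiv (n y)) with ht
    set e := ‖g.linearIsometryEquiv (n y) - n y‖ with he
    have he0 : 0 ≤ e := norm_nonneg _
    have he1 : e < 1 := hsmall.trans_le (min_le_left _ _)
    have he2 : e < η := hsmall.trans_le (min_le_right _ _)
    have hee : e ^ 2 ≤ e := by nlinarith
    have ht2 : t ^ 2 = 1 := hq (by nlinarith)
    have htpos : 0 < t := by nlinarith
    have ht1 : t = 1 := by nlinarith
    exact ((inner_eq_one_iff_of_norm_eq_one hn hn').1 ht1).symm
  have hv : v ∈ Submodule.span ℝ (n '' (s : Set (EuclideanSpace ℝ (Fin d)))) := by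
    rw [hspan]; trivial
  induction hv using Submodule.span_induction with
  | mem u hu =>
    obtain ⟨y, hy, rfl⟩ := hu
    exact hfix y hy
  | zero => simp
  | add a b _ _ ha hb => rw [map_add, ha, hb]
  | smul t a _ ha => rw [map_smul, ha]

/-- The vectors of the translations belonging to a group of isometries. -/
def translationVectors
    (G : Subgroup (EuclideanSpace ℝ (Fin d) ≃ᵃⁱ[ℝ] EuclideanSpace ℝ (Fin d))) :
    AddSubgroup (EuclideanSpace ℝ (Fin d)) where
  carrier := {v | AffineIsometryEquiv.constVAdd ℝ (EuclideanSpace ℝ (Fin d)) v ∈ G}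
  add_mem' {a b} ha hb := by
    have : AffineIsometryEquiv.constVAdd ℝ (EuclideanSpace ℝ (Fin d)) (a + b) =
        AffineIsometryEquiv.constVAdd ℝ (EuclideanSpace ℝ (Fin d)) a *
        AffineIsometryEquiv.constVAdd ℝ (EuclideanSpace ℝ (Fin d)) b :=
      AffineIsometryEquiv.ext fun x => add_assoc a b x
    rw [Set.mem_ofPred_eq, this]
    exact mul_mem ha hb
  zero_mem' := by
    have : AffineIsometryEquiv.constVAdd ℝ (EuclideanSpace ℝ (Fin d)) 0 =
        (1 : EuclideanSpace ℝ (Fin d) ≃ᵃⁱ[ℝ] EuclideanSpace ℝ (Fin d)) :=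
      AffineIsometryEquiv.ext fun x => zero_add x
    rw [Set.mem_ofPred_eq, this]
    exact one_mem _
  neg_mem' {a} ha := by
    have : AffineIsometryEquiv.constVAdd ℝ (EuclideanSpace ℝ (Fin d)) (-a) =
        (AffineIsometryEquiv.constVAdd ℝ (EuclideanSpace ℝ (Fin d)) a)⁻¹ :=
      AffineIsometryEquiv.ext fun x => rfl
    rw [Set.mem_ofPred_eq, this]
    exact inv_mem ha

/-- The group of the translations belonging to `Γ`. -/
noncomputable abbrev translationGroup (K : SimplicialComplex ℝ (EuclideanSpace ℝ (Fin d))) :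
    AddSubgroup (EuclideanSpace ℝ (Fin d)) :=
  translationVectors K.reflectionGroup

theorem mem_translationGroup {v : EuclideanSpace ℝ (Fin d)} : v ∈ K.translationGroup ↔
    AffineIsometryEquiv.constVAdd ℝ (EuclideanSpace ℝ (Fin d)) v ∈ K.reflectionGroup := Iff.rfl

/-- The translations in `Γ` span `ℝᵈ`. -/
theorem IsCoxeterComplex.span_translationGroup (hd : 1 ≤ d) (hK : K.IsCoxeterComplex) :
    Submodule.span ℝ (K.translationGroup : Set (EuclideanSpace ℝ (Fin d))) = ⊤ := by
  by_contra hne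
  rw [← Submodule.orthogonal_eq_bot_iff, Submodule.eq_bot_iff] at hne
  push Not at hne
  obtain ⟨w, hw, hw0⟩ := hne
  set u := ‖w‖⁻¹ • w with hu
  have hu1 : ‖u‖ = 1 := by
    rw [hu, norm_smul, norm_inv, norm_norm, inv_mul_cancel₀ (norm_ne_zero_iff.2 hw0)]
  have hperp : ∀ v ∈ K.translationGroup, inner ℝ u v = 0 := fun v hv => by
    rw [real_inner_comm]
    exact (Submodule.smul_mem _ ‖w‖⁻¹ hw) v (Submodule.subset_span hv)
  clear_value u
  obtain ⟨s, hs, hx₀⟩ := hK.isTriangulation.exists_chamber 0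
  obtain ⟨D, hD⟩ := (isCompact_hull s).isBounded.exists_norm_le
  have hD0 : 0 ≤ D := (norm_nonneg _).trans (hD 0 hx₀)
  have happrox : ∀ q, ∃ g ∈ K.reflectionGroup, ‖g 0 - q‖ ≤ D := by
    intro q
    obtain ⟨g, hg, hgq⟩ := hK.exists_mem_hull hs q
    refine ⟨g⁻¹, inv_mem hg, ?_⟩
    have h1 := hD _ hgq
    have h2 : dist (g⁻¹ 0) q = dist (0 : EuclideanSpace ℝ (Fin d)) (g q) := by
      rw [← g.dist_map]
      congr 1
      exact g.apply_symm_apply 0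
    rw [← dist_eq_norm, h2, dist_zero_left]
    exact h1
  -- Each orbit point misses its target by at most `D`; the spacing `2 * D + 1` exceeds the joint
  -- error of two of them, so their difference has a nonzero component along `u`.
  choose g hg hgd using fun k : ℕ => happrox (((k : ℝ) * (2 * D + 1)) • u)
  let G : ℕ → EuclideanSpace ℝ (Fin d) →L[ℝ] EuclideanSpace ℝ (Fin d) := fun k =>
    (g k).linearIsometryEquiv.toContinuousLinearEquiv.toContinuousLinearMap
  have hG : ∀ k, G k ∈ Metric.closedBall
      (0 : EuclideanSpace ℝ (Fin d) →L[ℝ] EuclideanSpace ℝ (Fin d)) 1 := fun k => by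
    rw [mem_closedBall_zero_iff]
    refine ContinuousLinearMap.opNorm_le_bound _ zero_le_one fun v => ?_
    rw [one_mul]
    exact ((g k).linearIsometryEquiv.norm_map v).le
  have : ProperSpace (EuclideanSpace ℝ (Fin d) →L[ℝ] EuclideanSpace ℝ (Fin d)) :=
    FiniteDimensional.proper ℝ _
  obtain ⟨a, -, φ, hφ, hlim⟩ := (isCompact_closedBall _ _).tendsto_subseq hG
  obtain ⟨ε, hε, hsmall⟩ := hK.exists_small hd
  obtain ⟨N, hN⟩ := Metric.cauchySeq_iff.1 hlim.cauchySeq ε hε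
  have hclose := hN (N + 1) (Nat.le_succ N) N le_rfl
  rw [dist_eq_norm] at hclose
  set j := φ N
  set k := φ (N + 1)
  have hjk : j < k := hφ (Nat.lt_succ_self N)
  -- Two linear parts from a convergent subsequence are close, so the quotient of the two elements
  -- is a translation.
  have hid := hsmall (g k * (g j)⁻¹) (mul_mem (hg k) (inv_mem (hg j))) (fun v hv => by
    obtain ⟨v, rfl⟩ := (g j).linearIsometryEquiv.surjective v
    have h1 : (g k * (g j)⁻¹).linearIsometryEquiv ((g j).linearIsometryEquiv v) = G k v := by
      change (g k).linearIsometryEquiv ((g j).linearIsometryEquiv.symm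
        ((g j).linearIsometryEquiv v)) = _
      rw [LinearIsometryEquiv.symm_apply_apply]
      rfl
    rw [LinearIsometryEquiv.norm_map] at hv
    rw [h1]
    refine lt_of_le_of_lt ?_ hclose
    have := (G k - G j).le_opNorm v
    rw [hv, mul_one] at this
    exact this)
  set τ := g k 0 - g j 0 with hτ
  have htr : AffineIsometryEquiv.constVAdd ℝ (EuclideanSpace ℝ (Fin d)) τ = g k * (g j)⁻¹ := by
    refine AffineIsometryEquiv.ext fun x => ?_
    have h1 := (g k * (g j)⁻¹).map_vsub x (g j 0)
    have h2 : (g k * (g j)⁻¹) (g j 0) = g k 0 := by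
      change g k ((g j).symm (g j 0)) = _
      rw [AffineIsometryEquiv.symm_apply_apply]
    rw [hid, h2] at h1
    simp only [vsub_eq_sub] at h1
    change τ + x = _
    rw [hτ, sub_eq_iff_eq_add.1 h1.symm]
    abel
  have hτm : τ ∈ K.translationGroup := by
    rw [mem_translationGroup, htr]
    exact mul_mem (hg k) (inv_mem (hg j))
  have h0 := hperp τ hτm
  have hτ' : τ = ((k : ℝ) * (2 * D + 1)) • u - ((j : ℝ) * (2 * D + 1)) • u +
      ((g k 0 - ((k : ℝ) * (2 * D + 1)) • u) - (g j 0 - ((j : ℝ) * (2 * D + 1)) • u)) := by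
    rw [hτ]; abel
  have hb : |inner ℝ u ((g k 0 - ((k : ℝ) * (2 * D + 1)) • u) -
      (g j 0 - ((j : ℝ) * (2 * D + 1)) • u))| ≤ 2 * D := by
    refine (abs_real_inner_le_norm _ _).trans ?_
    rw [hu1, one_mul]
    refine (norm_sub_le _ _).trans ?_
    linarith [hgd k, hgd j]
  rw [hτ', inner_add_right, inner_sub_right, inner_smul_right, inner_smul_right,
    real_inner_self_eq_norm_sq, hu1] at h0
  have hjk' : (j : ℝ) + 1 ≤ k := by exact_mod_cast hjk
  have := neg_le_of_abs_le hb
  nlinarith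

theorem IsCoxeterComplex.map_vertex (hK : K.IsCoxeterComplex)
    {g : EuclideanSpace ℝ (Fin d) ≃ᵃⁱ[ℝ] EuclideanSpace ℝ (Fin d)} (hg : g ∈ K.reflectionGroup)
    {x : EuclideanSpace ℝ (Fin d)} (hx : x ∈ K.vertices) : g x ∈ K.vertices := by
  have h := hK.preserves g hg _ (mem_vertices.1 hx)
  rw [Finset.map_singleton] at h
  exact h

/-- Two points are the end points of an edge of the complex. -/
def EdgeRel (K : SimplicialComplex ℝ (EuclideanSpace ℝ (Fin d)))
    (x y : EuclideanSpace ℝ (Fin d)) : Prop :=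
  x ≠ y ∧ ∃ s ∈ K.faces, (s : Set (EuclideanSpace ℝ (Fin d))) = {x, y}

theorem adj_iff {x y : K.vertices} : K.oneSkeleton.Adj x y ↔ K.EdgeRel x y := by
  rw [EdgeRel, Ne, ← Subtype.ext_iff]
  exact Iff.rfl

theorem IsCoxeterComplex.map_edge (hK : K.IsCoxeterComplex)
    {g : EuclideanSpace ℝ (Fin d) ≃ᵃⁱ[ℝ] EuclideanSpace ℝ (Fin d)} (hg : g ∈ K.reflectionGroup)
    {x y : EuclideanSpace ℝ (Fin d)} (h : K.EdgeRel x y) : K.EdgeRel (g x) (g y) := by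
  obtain ⟨hne, s, hs, he⟩ := h
  refine ⟨fun h => hne (g.injective h), _, hK.preserves g hg s hs, ?_⟩
  rw [Finset.coe_map, he, Set.image_pair]
  rfl

theorem IsCoxeterComplex.nonempty_vertices (hK : K.IsCoxeterComplex) : K.vertices.Nonempty := by
  obtain ⟨s, hs, -⟩ := hK.isTriangulation.exists_chamber 0
  obtain ⟨x, hx⟩ := K.nonempty_of_mem_faces hs.1
  exact ⟨x, mem_vertices_of_mem hs.1 hx⟩

/-- Translations of bounded length carry a fixed vertex to distinct vertices in a ball, and there
are finitely many of those. -/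
theorem IsCoxeterComplex.discrete_translationGroup (hK : K.IsCoxeterComplex) :
    DiscreteTopology K.translationGroup := by
  obtain ⟨x, hx⟩ := hK.nonempty_vertices
  have hfin : {v | v ∈ K.translationGroup ∧ ‖v‖ ≤ 1}.Finite := by
    refine Set.Finite.of_finite_image (f := fun v => v + x)
      ((hK.isTriangulation.finite_vertices (isCompact_closedBall x 1)).subset ?_)
      (add_left_injective x).injOn
    rintro _ ⟨v, ⟨hv, hv1⟩, rfl⟩
    exact ⟨hK.map_vertex hv hx, by simpa [Metric.mem_closedBall, dist_eq_norm] using hv1⟩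
  obtain ⟨ε, hε, hball⟩ := Metric.isOpen_iff.1
    (hfin.subset Set.sdiff_subset :
      ({v | v ∈ K.translationGroup ∧ ‖v‖ ≤ 1} \ {0}).Finite).isClosed.isOpen_compl 0 (by simp)
  refine discreteTopology_of_isOpen_singleton_zero (Metric.isOpen_iff.2 ?_)
  rintro v rfl
  refine ⟨min ε 1, lt_min hε one_pos, fun v hv => ?_⟩
  rw [Metric.mem_ball, Subtype.dist_eq] at hv
  have h1 : dist (v : EuclideanSpace ℝ (Fin d)) 0 < ε := hv.trans_le (min_le_left _ _)
  have h2 : dist (v : EuclideanSpace ℝ (Fin d)) 0 < 1 := hv.trans_le (min_le_right _ _)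
  rw [dist_zero_right] at h2
  by_contra hne
  exact hball h1 ⟨⟨v.2, h2.le⟩, fun h => hne (Subtype.ext h)⟩

/-- Subtracting the integral part of `x` in a basis made of translation vectors leaves a bounded
fractional part. -/
theorem IsCoxeterComplex.exists_translation (hd : 1 ≤ d) (hK : K.IsCoxeterComplex) :
    ∃ R : ℝ, ∀ x : EuclideanSpace ℝ (Fin d), ∃ v ∈ K.translationGroup, ‖v + x‖ ≤ R := by
  have hs := (hK.span_translationGroup hd).ge
  let b := Module.Basis.ofSpan hs
  have : Finite _ := Module.Finite.finite_basis b
  have := Fintype.ofFinite ((linearIndepOn_empty ℝ id).extend (Set.empty_subset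
    (K.translationGroup : Set (EuclideanSpace ℝ (Fin d)))))
  refine ⟨∑ i, ‖b i‖, fun x => ⟨-(ZSpan.floor b x), ?_, ?_⟩⟩
  · refine neg_mem ?_
    have hsub : Submodule.span ℤ (Set.range b) ≤ AddSubgroup.toIntSubmodule K.translationGroup :=
      Submodule.span_le.2 (Module.Basis.ofSpan_subset hs)
    exact hsub (ZSpan.floor b x).2
  · rw [neg_add_eq_sub, ← ZSpan.fract_apply]
    exact ZSpan.norm_fract_le b x

end Geometry.SimplicialComplex

/-! ### Existence of the crystal structure -/

namespace TopologicalCrystal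

/-- The quotient of a connected graph by a free action of a free abelian group of rank `d`, with
finitely many orbits and without inversions. -/
noncomputable def ofAction {V E : Type*} (X : DirGraph V E) (d : ℕ) (hX : X.Connected) (L : Type*)
    [AddCommGroup L] [Module.Free ℤ L] [Module.Finite ℤ L] (hL : Module.finrank ℤ L = d)
    [AddAction L V] [AddAction L E]
    (act_o : ∀ (σ : L) e, X.o (σ +ᵥ e) = σ +ᵥ X.o e)
    (act_t : ∀ (σ : L) e, X.t (σ +ᵥ e) = σ +ᵥ X.t e)
    (act_inv : ∀ (σ : L) e, X.inv (σ +ᵥ e) = σ +ᵥ X.inv e)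
    (act_free : ∀ (σ : L) (x : V), σ +ᵥ x = x → σ = 0)
    (act_ne_inv : ∀ (σ : L) e, σ +ᵥ e ≠ X.inv e)
    (hV : Finite (Quotient (AddAction.orbitRel L V)))
    (hE : Finite (Quotient (AddAction.orbitRel L E))) :
    TopologicalCrystal X d where
  connected := hX
  V₀ := Quotient (AddAction.orbitRel L V)
  E₀ := Quotient (AddAction.orbitRel L E)
  base :=
    { o := Quotient.map X.o (by rintro _ e ⟨σ, rfl⟩; exact ⟨σ, (act_o σ e).symm⟩)
      t := Quotient.map X.t (by rintro _ e ⟨σ, rfl⟩; exact ⟨σ, (act_t σ e).symm⟩)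
      inv := Quotient.map X.inv (by rintro _ e ⟨σ, rfl⟩; exact ⟨σ, (act_inv σ e).symm⟩)
      inv_inv := by
        intro e
        induction e using Quotient.inductionOn
        simp [X.inv_inv]
      inv_ne := by
        intro e h
        induction e using Quotient.inductionOn with
        | h e =>
          obtain ⟨σ, hσ⟩ := Quotient.exact h
          exact act_ne_inv σ e hσ
      o_inv := by
        intro e
        induction e using Quotient.inductionOn
        simp [X.o_inv]
      t_inv := by
        intro e
        induction e using Quotient.inductionOn
        simp [X.t_inv] }
  projV := Quotient.mk _
  projE := Quotient.mk _
  proj_o _ := rfl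
  proj_t _ := rfl
  proj_inv _ := rfl
  proj_surjective := Quotient.mk_surjective
  proj_bijOn x := by
    refine ⟨fun e he => ?_, fun e he e' he' h => ?_, fun f hf => ?_⟩
    · exact congrArg (Quotient.mk _) he
    · obtain ⟨σ, hσ⟩ := Quotient.exact h
      have h1 : σ +ᵥ X.o e' = X.o e := by rw [← act_o]; exact congrArg X.o hσ
      rw [show X.o e = x from he, show X.o e' = x from he'] at h1
      rw [act_free σ x h1] at hσ
      exact (hσ.symm.trans (zero_vadd L e'))
    · induction f using Quotient.inductionOn with
      | h e =>
        obtain ⟨σ, hσ⟩ := Quotient.exact hf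
        refine ⟨-σ +ᵥ e, ?_, Quotient.sound ⟨-σ, rfl⟩⟩
        change X.o (-σ +ᵥ e) = x
        rw [act_o, ← hσ]
        exact neg_vadd_vadd σ x
  L := L
  finrank_L := hL
  act_o := act_o
  act_t := act_t
  act_inv := act_inv
  act_free := act_free
  projE_act σ e := Quotient.sound ⟨σ, rfl⟩
  projV_eq_iff x y := by
    refine Quotient.eq.trans ⟨?_, ?_⟩
    · rintro ⟨σ, rfl⟩
      exact ⟨-σ, neg_vadd_vadd σ y⟩
    · rintro ⟨σ, rfl⟩
      exact ⟨-σ, neg_vadd_vadd σ x⟩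

end TopologicalCrystal

namespace Geometry.SimplicialComplex

variable {d : ℕ} {K : SimplicialComplex ℝ (EuclideanSpace ℝ (Fin d))}

/-- The covering group is the full translation group of `Γ`. Every orbit of vertices or edges meets
a fixed ball, so the quotient is finite; a translation `σ` exchanging the ends of an edge would
satisfy `2σ = 0`. -/
theorem IsCoxeterComplex.exists_crystal (hd : 1 ≤ d) (hK : K.IsCoxeterComplex) :
    ∃ (C : TopologicalCrystal.{0, 0, 0, 0, 0} K.oneSkeleton.toDirGraph d)
        (ρ : C.L →+ EuclideanSpace ℝ (Fin d)),
        C.IsPeriodHom (fun x : K.vertices => (x : EuclideanSpace ℝ (Fin d))) ρ ∧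
        ∀ σ : C.L, AffineIsometryEquiv.constVAdd ℝ (EuclideanSpace ℝ (Fin d)) (ρ σ) ∈
          K.reflectionGroup := by
  have hdisc := hK.discrete_translationGroup
  have hdisc' : DiscreteTopology (AddSubgroup.toIntSubmodule K.translationGroup) := hdisc
  have hlat : IsZLattice ℝ (AddSubgroup.toIntSubmodule K.translationGroup) :=
    ⟨hK.span_translationGroup hd⟩
  have hfree : Module.Free ℤ K.translationGroup :=
    ZLattice.module_free ℝ (AddSubgroup.toIntSubmodule K.translationGroup)
  have hfin : Module.Finite ℤ K.translationGroup :=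
    ZLattice.module_finite ℝ (AddSubgroup.toIntSubmodule K.translationGroup)
  have hrank : Module.finrank ℤ K.translationGroup = d :=
    (ZLattice.rank ℝ (AddSubgroup.toIntSubmodule K.translationGroup)).trans
      finrank_euclideanSpace_fin
  let actV : AddAction K.translationGroup K.vertices :=
    { vadd := fun v x => ⟨v.1 + x.1, hK.map_vertex v.2 x.2⟩
      zero_vadd := fun x => Subtype.ext (zero_add x.1)
      add_vadd := fun v w x => Subtype.ext (add_assoc v.1 w.1 x.1) }
  let actE : AddAction K.translationGroup K.oneSkeleton.Dart :=
    { vadd := fun v e => ⟨(v +ᵥ e.fst, v +ᵥ e.snd), adj_iff.2 (hK.map_edge v.2 (adj_iff.1 e.adj))⟩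
      zero_vadd := fun e => SimpleGraph.Dart.ext _ _ (Prod.ext (zero_vadd _ _) (zero_vadd _ _))
      add_vadd := fun v w e =>
        SimpleGraph.Dart.ext _ _ (Prod.ext (add_vadd _ _ _) (add_vadd _ _ _)) }
  obtain ⟨R, hR⟩ := hK.exists_translation hd
  have hfaces := hK.isTriangulation.finite_faces
    (isCompact_closedBall (0 : EuclideanSpace ℝ (Fin d)) R)
  have hV : Finite (Quotient (AddAction.orbitRel K.translationGroup K.vertices)) := by
    have hS := (hK.isTriangulation.finite_vertices (isCompact_closedBall
      (0 : EuclideanSpace ℝ (Fin d)) R)).to_subtype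
    refine Finite.of_surjective (fun x : ↥(K.vertices ∩ Metric.closedBall 0 R) =>
      (Quotient.mk _ (⟨x.1, x.2.1⟩ : K.vertices) :
        Quotient (AddAction.orbitRel K.translationGroup K.vertices))) fun q => ?_
    induction q using Quotient.inductionOn with
    | h x =>
      obtain ⟨v, hv, hvx⟩ := hR x
      exact ⟨⟨v + x, hK.map_vertex hv x.2, by simpa using hvx⟩, Quotient.sound ⟨⟨v, hv⟩, rfl⟩⟩
  have hE : Finite (Quotient (AddAction.orbitRel K.translationGroup K.oneSkeleton.Dart)) := by
    set F := {s | s ∈ K.faces ∧ (convexHull ℝ (s : Set (EuclideanSpace ℝ (Fin d))) ∩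
      Metric.closedBall (0 : EuclideanSpace ℝ (Fin d)) R).Nonempty} with hF
    have hU : (⋃ t ∈ F, (t : Set (EuclideanSpace ℝ (Fin d)))).Finite :=
      hfaces.biUnion fun t _ => t.finite_toSet
    have hS : {e : K.oneSkeleton.Dart | ‖e.fst.1‖ ≤ R}.Finite := by
      refine Set.Finite.of_finite_image (f := fun e => (e.fst.1, e.snd.1))
        ((hU.prod hU).subset ?_) ?_
      · rintro _ ⟨e, he, rfl⟩
        obtain ⟨s, hs, hse⟩ := e.adj.2
        have h1 : e.fst.1 ∈ (s : Set (EuclideanSpace ℝ (Fin d))) := by rw [hse]; simp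
        have h2 : e.snd.1 ∈ (s : Set (EuclideanSpace ℝ (Fin d))) := by rw [hse]; simp
        have hsF : s ∈ F := ⟨hs, e.fst.1, subset_convexHull _ _ h1, by simpa using he⟩
        exact ⟨Set.mem_biUnion hsF h1, Set.mem_biUnion hsF h2⟩
      · intro e _ e' _ h
        exact SimpleGraph.Dart.ext _ _ (Prod.ext (Subtype.ext (congrArg Prod.fst h))
          (Subtype.ext (congrArg Prod.snd h)))
    have hS' := hS.to_subtype
    refine Finite.of_surjective (fun e : {e : K.oneSkeleton.Dart | ‖e.fst.1‖ ≤ R} =>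
      (Quotient.mk _ e.1 :
        Quotient (AddAction.orbitRel K.translationGroup K.oneSkeleton.Dart))) fun q => ?_
    induction q using Quotient.inductionOn with
    | h e =>
      obtain ⟨v, hv, hvx⟩ := hR e.fst
      exact ⟨⟨(⟨v, hv⟩ : K.translationGroup) +ᵥ e, hvx⟩, Quotient.sound ⟨⟨v, hv⟩, rfl⟩⟩
  have hrange : DiscreteTopology K.translationGroup.subtype.range := by
    rw [AddSubgroup.range_subtype]
    exact hdisc
  refine ⟨TopologicalCrystal.ofAction _ d hK.isTriangulation.connected K.translationGroup hrank
    (fun _ _ => rfl) (fun _ _ => rfl) (fun _ _ => rfl) (fun σ x h => ?_) (fun σ e h => ?_) hV hE,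
    K.translationGroup.subtype, ⟨Subtype.val_injective, ?_, ?_, fun σ x => ?_⟩, fun σ => σ.2⟩
  · exact Subtype.ext (add_eq_right.1 (congrArg Subtype.val h))
  · have h1 : σ.1 + e.fst.1 = e.snd.1 :=
      congrArg (fun e : K.oneSkeleton.Dart => e.fst.1) h
    have h2 : σ.1 + e.snd.1 = e.fst.1 :=
      congrArg (fun e : K.oneSkeleton.Dart => e.snd.1) h
    rw [← h1, ← add_assoc, add_eq_right, ← two_smul ℝ, smul_eq_zero] at h2
    rw [h2.resolve_left two_ne_zero, zero_add] at h1
    exact e.adj.1 (Subtype.ext h1)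
  · exact hrange
  · have : Set.range K.translationGroup.subtype = K.translationGroup := Subtype.range_coe
    exact (congrArg (Submodule.span ℝ) this).trans (hK.span_translationGroup hd)
  · exact add_comm _ _

end Geometry.SimplicialComplex

/-! ### Chains, coboundaries and the inner product -/

namespace DirGraph

variable {V E : Type*} (X : DirGraph V E)

theorem mapDomain_inv (R : Type*) [CommRing R] (c : X.C₁ R) :
    Finsupp.mapDomain X.inv (X.coeff R c) = - X.coeff R c := by
  ext e
  have h := Finsupp.mapDomain_apply X.inv_injective (X.coeff R c) (X.inv e)
  rw [X.inv_inv, X.coeff_inv] at h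
  simpa using h

theorem linearCombination_inv {R M : Type*} [CommRing R] [AddCommGroup M] [Module R M]
    (h : E → M) (c : X.C₁ R) :
    Finsupp.linearCombination R (h ∘ X.inv) (X.coeff R c) =
      - Finsupp.linearCombination R h (X.coeff R c) := by
  rw [← Finsupp.linearCombination_mapDomain, mapDomain_inv, map_neg]

/-- Summation by parts: a coboundary paired with a chain. -/
theorem linearCombination_coboundary {R M : Type*} [CommRing R] [AddCommGroup M] [Module R M]
    (ψ : V → M) (c : X.C₁ R) :
    Finsupp.linearCombination R (fun e => ψ (X.t e) - ψ (X.o e)) (X.coeff R c) =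
      (2 : R) • Finsupp.linearCombination R ψ (X.boundary R c) := by
  have h1 : Finsupp.linearCombination R ψ (X.boundary R c) =
      Finsupp.linearCombination R (ψ ∘ X.t) (X.coeff R c) :=
    Finsupp.linearCombination_mapDomain R _ _
  -- Both directions of an edge are summed, so origins contribute the same as termini; hence the
  -- factor 2.
  have h2 : Finsupp.linearCombination R (ψ ∘ X.o) (X.coeff R c) =
      - Finsupp.linearCombination R (ψ ∘ X.t) (X.coeff R c) := by
    rw [← linearCombination_inv]
    congr 2
    funext e
    simp [X.t_inv]
  have h3 : Finsupp.linearCombination R (fun e => ψ (X.t e) - ψ (X.o e)) (X.coeff R c) =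
      Finsupp.linearCombination R (ψ ∘ X.t) (X.coeff R c) -
        Finsupp.linearCombination R (ψ ∘ X.o) (X.coeff R c) := by
    simp only [Finsupp.linearCombination_apply, Function.comp, Finsupp.sum, smul_sub,
      Finset.sum_sub_distrib]
  rw [h3, h2, h1, two_smul, sub_neg_eq_add]

/-- Every path in a connected graph gives a chain with the expected boundary. -/
theorem Connected.exists_chain {X : DirGraph V E} (hX : X.Connected) (R : Type*) [CommRing R]
    (x y : V) :
    ∃ p : X.C₁ R, X.boundary R p = Finsupp.single y 1 - Finsupp.single x 1 := by
  induction hX.2 x y with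
  | refl => exact ⟨0, by simp⟩
  | tail _ h ih =>
    obtain ⟨p, hp⟩ := ih
    obtain ⟨e, rfl, rfl⟩ := h
    exact ⟨p + X.edgeChain R e, by rw [map_add, hp, boundary_edgeChain, sub_add_sub_cancel']⟩

theorem inner_intToReal (b : X.C₁ ℤ) (c : X.C₁ ℝ) :
    inner ℝ (X.intToReal b) c =
      (1 / 2) * Finsupp.linearCombination ℤ (X.coeff ℝ c) (X.coeff ℤ b) := by
  classical
  rw [inner_def, Finsupp.linearCombination_apply]
  congr 1
  rw [Finsupp.sum_of_support_subset (s := (X.coeff ℤ b).support), Finsupp.sum]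
  · refine Finset.sum_congr rfl fun e _ => ?_
    rw [coeff_intToReal, zsmul_eq_mul]
  · intro e he
    rw [Finsupp.mem_support_iff, coeff_intToReal] at he
    rw [Finsupp.mem_support_iff]
    exact_mod_cast he
  · simp

theorem inner_eq_linearCombination (b c : X.C₁ ℝ) :
    inner ℝ b c =
      (1 / 2) * Finsupp.linearCombination ℝ (X.coeff ℝ c) (X.coeff ℝ b) := by
  rw [inner_def, Finsupp.linearCombination_apply]
  rfl

/-- The two directions cancel the factor `1 / 2`: pairing with an edge is evaluation there. -/
theorem inner_edgeChain (e : E) (c : X.C₁ ℝ) :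
    inner ℝ (X.edgeChain ℝ e) c = X.coeff ℝ c e := by
  rw [inner_eq_linearCombination, coeff_edgeChain, map_sub, Finsupp.linearCombination_single,
    Finsupp.linearCombination_single, coeff_inv]
  simp only [one_smul]
  ring

theorem intToReal_edgeChain (e : E) : X.intToReal (X.edgeChain ℤ e) = X.edgeChain ℝ e := by
  classical
  apply X.coeff_injective ℝ
  ext f
  rw [coeff_intToReal, coeff_edgeChain, coeff_edgeChain]
  simp [Finsupp.single_apply]

/-- An antisymmetric function on the directed edges of a finite graph, as a chain. -/
noncomputable def chainOfFun [Finite E] (a : E → ℝ) (ha : ∀ e, a (X.inv e) = - a e) : X.C₁ ℝ :=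
  ⟨Finsupp.equivFunOnFinite.symm a, ha⟩

end DirGraph

/-! ### Harmonic tight realizations are standard -/

namespace TopologicalCrystal

variable {V E : Type*} {X : DirGraph V E} {d : ℕ} (C : TopologicalCrystal X d)

theorem projE_surjective : Function.Surjective C.projE := by
  intro f
  obtain ⟨x, hx⟩ := C.proj_surjective (C.base.o f)
  obtain ⟨e, -, he⟩ := (C.proj_bijOn x).surjOn (show f ∈ {f | C.base.o f = C.projV x} from hx.symm)
  exact ⟨e, he⟩

/-- Transitivity on the fibre moves one origin to the other; edges with the same origin and image
coincide by local injectivity. -/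
theorem exists_vadd_eq {e e' : E} (h : C.projE e = C.projE e') : ∃ σ : C.L, σ +ᵥ e = e' := by
  have h1 : C.projV (X.o e) = C.projV (X.o e') := by rw [← C.proj_o, ← C.proj_o, h]
  obtain ⟨σ, hσ⟩ := (C.projV_eq_iff _ _).1 h1
  exact ⟨σ, (C.proj_bijOn (X.o e')).injOn (by rw [Set.mem_ofPred_eq, C.act_o, hσ]) rfl
    (by rw [C.projE_act, h])⟩

theorem linearCombination_push {M : Type*} [AddCommGroup M] (h : C.E₀ → M) (c : X.C₁ ℤ) :
    Finsupp.linearCombination ℤ h (C.base.coeff ℤ (C.push c)) =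
      Finsupp.linearCombination ℤ (h ∘ C.projE) (X.coeff ℤ c) := by
  rw [coeff_push, Finsupp.linearCombination_mapDomain]

theorem push_edgeChain (e : E) : C.push (X.edgeChain ℤ e) = C.base.edgeChain ℤ (C.projE e) := by
  apply C.base.coeff_injective ℤ
  change Finsupp.lmapDomain ℤ ℤ C.projE (X.coeff ℤ (X.edgeChain ℤ e)) = _
  rw [DirGraph.coeff_edgeChain, DirGraph.coeff_edgeChain, C.proj_inv, map_sub]
  simp [Finsupp.mapDomain_single]

/-- The orthogonal complement of `H_ℝ` in `H₁(X₀, ℝ)` has dimension at most `d`. -/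
theorem finrank_vanishingPerp_le : Module.finrank ℝ C.vanishingPerp ≤ d := by
  have := Fintype.ofFinite C.V₀
  have := Fintype.ofFinite C.E₀
  obtain ⟨x₀⟩ := C.connected.1
  choose p hp using fun x => C.connected.exists_chain ℤ x₀ x
  -- The image of a path from `x₀` to `x`. Modulo `H_ℝ` its choice is irrelevant, so pairing with `c
  -- ∈ H_ℝ^⊥` gives a potential of `c` on `X`.
  set q : V → C.base.C₁ ℝ := fun x => C.base.intToReal (C.push (p x)) with hq
  have hdq : ∀ e, ∀ c ∈ C.vanishingPerp,
      inner ℝ (q (X.t e)) c - inner ℝ (q (X.o e)) c = C.base.coeff ℝ c (C.projE e) := by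
    intro e c hc
    have hz : p (X.t e) - p (X.o e) - X.edgeChain ℤ e ∈ X.H₁ ℤ := by
      rw [DirGraph.H₁, LinearMap.mem_ker, map_sub, map_sub, hp, hp, DirGraph.boundary_edgeChain,
        sub_sub_sub_cancel_right, sub_self]
    have hmem : q (X.t e) - q (X.o e) - C.base.edgeChain ℝ (C.projE e) ∈ C.vanishingReal := by
      refine Submodule.subset_span ⟨_, Submodule.mem_map_of_mem hz, ?_⟩
      rw [map_sub, map_sub, map_sub, map_sub, push_edgeChain, DirGraph.intToReal_edgeChain]
    have h0 := hc.1 _ hmem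
    rw [inner_sub_left, inner_sub_left, DirGraph.inner_edgeChain] at h0
    linarith
  let b := Module.finBasisOfFinrankEq ℤ C.L C.finrank_L
  -- The periods of `c` along a basis of `L`.
  let Θ : C.vanishingPerp →ₗ[ℝ] (Fin d → ℝ) := LinearMap.pi fun i =>
    (innerₛₗ ℝ (q (b i +ᵥ x₀) - q x₀)).comp C.vanishingPerp.subtype
  have hΘ : Function.Injective Θ := by
    rw [injective_iff_map_eq_zero]
    rintro ⟨c, hc⟩ hΘc
    set f : V → ℝ := fun x => inner ℝ (q x) c with hf
    have hfe : ∀ e, f (X.t e) - f (X.o e) = C.base.coeff ℝ c (C.projE e) := fun e => hdq e c hc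
    have hχ : ∀ (σ : C.L) x, f (σ +ᵥ x) - f x = f (σ +ᵥ x₀) - f x₀ := by
      intro σ x
      induction C.connected.2 x₀ x with
      | refl => rfl
      | tail _ h ih =>
        obtain ⟨e, rfl, rfl⟩ := h
        have h1 := hfe e
        have h2 := hfe (σ +ᵥ e)
        rw [C.act_o, C.act_t, C.projE_act] at h2
        linarith
    let χ : C.L →+ ℝ :=
      { toFun := fun σ => f (σ +ᵥ x₀) - f x₀
        map_zero' := by rw [zero_vadd, sub_self]
        map_add' := fun σ τ => by
          have := hχ σ (τ +ᵥ x₀)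
          rw [add_vadd]
          linarith }
    have hχ0 : χ.toIntLinearMap = 0 := b.ext fun i => by
      have h := congrFun hΘc i
      have h' : inner ℝ (q (b i +ᵥ x₀) - q x₀) c = 0 := h
      rw [inner_sub_left] at h'
      exact h'
    have hinv : ∀ (σ : C.L) x, f (σ +ᵥ x) = f x := by
      intro σ x
      have h1 : f (σ +ᵥ x₀) - f x₀ = 0 := DFunLike.congr_fun hχ0 σ
      have h2 := hχ σ x
      linarith
    let F : C.V₀ → ℝ := fun a => f (Function.surjInv C.proj_surjective a)
    have hF : ∀ x, F (C.projV x) = f x := by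
      intro x
      obtain ⟨σ, hσ⟩ := (C.projV_eq_iff _ _).1
        (Function.surjInv_eq C.proj_surjective (C.projV x))
      have h : F (C.projV x) = f (Function.surjInv C.proj_surjective (C.projV x)) := rfl
      rw [h, ← hinv σ, hσ]
    -- With zero periods the potential descends to the base graph: `c` is a coboundary as well as a
    -- cycle, hence orthogonal to itself.
    have hcF : ⇑(C.base.coeff ℝ c) = fun e => F (C.base.t e) - F (C.base.o e) := by
      funext e₀
      obtain ⟨e, rfl⟩ := C.projE_surjective e₀
      rw [C.proj_t, C.proj_o, hF, hF, hfe]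
    have hcc : inner ℝ c c = 0 := by
      have hb : C.base.boundary ℝ c = 0 := hc.2
      rw [DirGraph.inner_eq_linearCombination]
      conv_lhs => enter [2, 1, 2]; rw [hcF]
      rw [DirGraph.linearCombination_coboundary, hb]
      simp
    exact Subtype.ext (inner_self_eq_zero.1 hcc)
  have h := LinearMap.finrank_le_finrank_of_injective hΘ
  rwa [Module.finrank_fin_fun] at h

/-- The displacement along the edges descends to the base graph. -/
theorem exists_displacement {Φ : V → EuclideanSpace ℝ (Fin d)} {ρ : C.L →+ EuclideanSpace ℝ (Fin d)}
    (hρ : C.IsPeriodHom Φ ρ) : ∃ w : C.E₀ → EuclideanSpace ℝ (Fin d),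
      ∀ e, w (C.projE e) = Φ (X.t e) - Φ (X.o e) := by
  refine ⟨fun f => Φ (X.t (Function.surjInv C.projE_surjective f)) -
    Φ (X.o (Function.surjInv C.projE_surjective f)), fun e => ?_⟩
  obtain ⟨σ, hσ⟩ := C.exists_vadd_eq (Function.surjInv_eq C.projE_surjective (C.projE e))
  have h1 := congrArg X.t hσ
  have h2 := congrArg X.o hσ
  rw [C.act_t] at h1
  rw [C.act_o] at h2
  rw [← h1, ← h2, hρ.2.2.2, hρ.2.2.2, add_sub_add_right_eq_sub]

open scoped Pointwise in
-- The normalized realization will be a rescaled copy of `Φ` and must itself be periodic.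
theorem IsPeriodHom.smul {C : TopologicalCrystal X d} {Φ : V → EuclideanSpace ℝ (Fin d)}
    {ρ : C.L →+ EuclideanSpace ℝ (Fin d)} (hρ : C.IsPeriodHom Φ ρ) {r : ℝ} (hr : r ≠ 0) :
    C.IsPeriodHom (fun x => r • Φ x) (r • ρ) := by
  obtain ⟨h1, h2, h3, h4⟩ := hρ
  refine ⟨(smul_right_injective _ hr).comp h1, ?_, ?_, fun σ x => ?_⟩
  · have hmem : ∀ x : (r • ρ).range, r⁻¹ • x.1 ∈ ρ.range := by
      rintro ⟨_, σ, rfl⟩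
      exact ⟨σ, (inv_smul_smul₀ hr _).symm⟩
    refine DiscreteTopology.of_continuous_injective (β := ρ.range)
      (f := fun x : (r • ρ).range => ⟨r⁻¹ • x.1, hmem x⟩)
      ((continuous_subtype_val.const_smul r⁻¹).subtype_mk _) ?_
    · intro x y hxy
      exact Subtype.ext (smul_right_injective _ (inv_ne_zero hr) (congrArg Subtype.val hxy))
  · have : Set.range ⇑(r • ρ) = r • Set.range ρ := Set.range_comp (r • ·) ρ
    rw [this, Submodule.span_smul_eq_of_isUnit _ _ (IsUnit.mk0 r hr), h3]
  · change r • Φ (σ +ᵥ x) = r • Φ x + r • ρ σ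
    rw [h4, smul_add]

/-- A harmonic periodic realization whose edges form a tight frame is standard. -/
theorem isStandard_of_tight [Fintype C.E₀] {Φ : V → EuclideanSpace ℝ (Fin d)}
    {ρ : C.L →+ EuclideanSpace ℝ (Fin d)} (hρ : C.IsPeriodHom Φ ρ)
    {w : C.E₀ → EuclideanSpace ℝ (Fin d)} (hw : ∀ e, w (C.projE e) = Φ (X.t e) - Φ (X.o e))
    (hharm : ∀ a : C.V₀, ∑ᶠ f ∈ {f | C.base.o f = a}, w f = 0)
    {k : ℝ} (hk : 0 < k) (htight : ∀ u, ∑ f, inner ℝ (w f) u • w f = k • u) :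
    C.IsStandard Φ := by
  classical
  have hwinv : ∀ f, w (C.base.inv f) = - w f := by
    intro f
    obtain ⟨e, rfl⟩ := C.projE_surjective f
    rw [C.proj_inv, hw, hw, X.t_inv, X.o_inv, neg_sub]
  have hT : ∀ v f, inner ℝ (w (C.base.inv f)) v = - inner ℝ (w f) v := fun v f => by
    rw [hwinv, inner_neg_left]
  let T : EuclideanSpace ℝ (Fin d) → C.base.C₁ ℝ := fun v =>
    C.base.chainOfFun (fun f => inner ℝ (w f) v) (hT v)
  have hTc : ∀ v, ⇑(C.base.coeff ℝ (T v)) = fun f => inner ℝ (w f) v := fun v => rfl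
  have hTmem : ∀ v, T v ∈ C.vanishingPerp := by
    intro v
    constructor
    · intro z hz
      induction hz using Submodule.span_induction with
      | mem z hz =>
        obtain ⟨_, ⟨c, hc, rfl⟩, rfl⟩ := hz
        have hc' : X.boundary ℤ c = 0 := hc
        rw [DirGraph.inner_intToReal, linearCombination_push]
        have : ⇑(C.base.coeff ℝ (T v)) ∘ C.projE =
            fun e => inner ℝ (Φ (X.t e)) v - inner ℝ (Φ (X.o e)) v := by
          funext e
          rw [Function.comp, hTc]
          simp only [hw, inner_sub_left]
        rw [this, X.linearCombination_coboundary (R := ℤ) (fun x => inner ℝ (Φ x) v), hc']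
        simp
      | zero => exact inner_zero_left _
      | add a b _ _ ha hb => rw [inner_add_left, ha, hb, add_zero]
      | smul t a _ ha => rw [real_inner_smul_left, ha, mul_zero]
    · change C.base.boundary ℝ (T v) = 0
      have key : ∀ a, ∑ f, (if C.base.o f = a then w f else 0) = 0 := by
        intro a
        rw [← Finset.sum_filter, ← finsum_mem_coe_finset]
        simpa using hharm a
      have key' : ∀ a, ∑ f, (if C.base.t f = a then w f else 0) = 0 := by
        intro a
        have hinvb : Function.Involutive C.base.inv := C.base.inv_inv
        rw [← (Equiv.sum_comp hinvb.toPerm _), ← neg_eq_zero, ← Finset.sum_neg_distrib]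
        refine (Finset.sum_congr rfl fun f _ => ?_).trans (key a)
        simp only [Function.Involutive.coe_toPerm, C.base.t_inv, hwinv]
        split_ifs <;> simp
      ext a
      have h1 : C.base.boundary ℝ (T v) =
          Finsupp.mapDomain C.base.t (C.base.coeff ℝ (T v)) := rfl
      rw [h1, Finsupp.mapDomain, Finsupp.sum_apply, Finsupp.sum_fintype _ _ (by simp)]
      have h2 := congrArg (fun z => inner ℝ z v) (key' a)
      simp only [sum_inner, inner_zero_left] at h2
      rw [Finsupp.zero_apply, ← h2]
      refine Finset.sum_congr rfl fun f _ => ?_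
      rw [Finsupp.single_apply, hTc]
      split_ifs <;> simp
  -- The chain inner product is half the sum over directed edges, so `T` scales lengths by `√(k /
  -- 2)`.
  set r : ℝ := Real.sqrt (k / 2) with hr
  have hr0 : 0 < r := Real.sqrt_pos.2 (by linarith)
  have hrr : r * r = k / 2 := Real.mul_self_sqrt (by linarith)
  have hTinner : ∀ u v, inner ℝ (T u) (T v) = (r * r) * inner ℝ u v := by
    intro u v
    have h := congrArg (fun z => inner ℝ z v) (htight u)
    simp only [sum_inner, real_inner_smul_left] at h
    rw [DirGraph.inner_def, Finsupp.sum_fintype _ _ (by simp), hTc, hTc, h, hrr]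
    ring
  let J₀ : EuclideanSpace ℝ (Fin d) →ₗ[ℝ] C.vanishingPerp :=
    { toFun := fun v => ⟨T (r⁻¹ • v), hTmem _⟩
      map_add' := fun u v => by
        apply Subtype.ext
        apply C.base.coeff_injective ℝ
        ext f
        change inner ℝ (w f) (r⁻¹ • (u + v)) = inner ℝ (w f) (r⁻¹ • u) + inner ℝ (w f) (r⁻¹ • v)
        rw [smul_add, inner_add_right]
      map_smul' := fun t v => by
        apply Subtype.ext
        apply C.base.coeff_injective ℝ
        ext f
        change inner ℝ (w f) (r⁻¹ • t • v) = t * inner ℝ (w f) (r⁻¹ • v)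
        rw [smul_comm, inner_smul_right] }
  have hJ₀ : ∀ u v, inner ℝ (J₀ u) (J₀ v) = inner ℝ u v := by
    intro u v
    change inner ℝ (T (r⁻¹ • u)) (T (r⁻¹ • v)) = _
    rw [hTinner, real_inner_smul_left, real_inner_smul_right]
    field_simp
  let J : EuclideanSpace ℝ (Fin d) →ₗᵢ[ℝ] C.vanishingPerp := J₀.isometryOfInner hJ₀
  -- The isometric embedding `J` and the upper bound on the dimension of `H_ℝ^⊥` make `J` onto.
  have hdim : Module.finrank ℝ (EuclideanSpace ℝ (Fin d)) = Module.finrank ℝ C.vanishingPerp := by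
    refine le_antisymm (LinearMap.finrank_le_finrank_of_injective (f := J.toLinearMap)
      J.injective) ?_
    rw [finrank_euclideanSpace_fin]
    exact C.finrank_vanishingPerp_le
  let Je := J.toLinearIsometryEquiv hdim
  -- Both projections are self-adjoint and fix the values of `J`, so the pairing reduces to
  -- evaluation at `f`.
  have hcochain : ∀ f, C.standardCochain f = Je (r⁻¹ • w f) := by
    intro f
    refine ext_inner_right ℝ fun z => ?_
    obtain ⟨u, rfl⟩ := Je.surjective z
    rw [LinearIsometryEquiv.inner_map_map, standardCochain,
      Submodule.inner_orthogonalProjectionOnto_eq_of_mem_right]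
    have hmem : ((Je u : C.vanishingPerp) : C.base.C₁ ℝ) ∈ C.base.H₁ ℝ := (Je u).2.2
    have h1 := Submodule.inner_orthogonalProjectionOnto_eq_of_mem_right
      (K := C.base.H₁ ℝ) ⟨_, hmem⟩ (C.base.edgeChain ℝ f)
    rw [Submodule.coe_inner] at h1
    rw [h1, DirGraph.inner_edgeChain]
    change inner ℝ (w f) (r⁻¹ • u) = _
    rw [real_inner_smul_left, real_inner_smul_right]
  refine ⟨fun x => r⁻¹ • Φ x, ⟨⟨_, hρ.smul (inv_ne_zero hr0.ne')⟩, Je.symm, fun e => ?_⟩,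
    r, LinearIsometryEquiv.refl ℝ _, 0, hr0, fun x => ?_⟩
  · rw [hcochain, LinearIsometryEquiv.symm_apply_apply, hw, smul_sub]
  · simp [smul_smul, hr0.ne']

end TopologicalCrystal

/-! ### Averaging over orbits of a larger translation group -/

/-- If a group `B` acts freely on `V` and `V₀` is the finite orbit set of a subgroup `A` of `B`,
then sums over `V₀` of `B`-invariant functions are invariant under the bijections of `V` which
permute the orbits of `B`. -/
theorem sum_orbits_comp {B V V₀ M : Type*} [AddCommGroup B] [AddAction B V] [Fintype V₀]
    [AddCommMonoid M] (A : AddSubgroup B) {p : V → V₀} {s : V₀ → V} (hs : ∀ a, p (s a) = a)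
    (hp : ∀ x y, p x = p y ↔ ∃ a ∈ A, a +ᵥ x = y) (hfree : ∀ (b : B) (x : V), b +ᵥ x = x → b = 0)
    (g : V ≃ V) (hg : ∀ x y, (∃ b : B, b +ᵥ x = y) ↔ ∃ b : B, b +ᵥ g x = g y)
    (G : V → M) (hG : ∀ (b : B) x, G (b +ᵥ x) = G x) :
    ∑ a, G (g (s a)) = ∑ a, G (s a) := by
  classical
  let r : Setoid V := ⟨fun x y => ∃ b : B, b +ᵥ x = y, fun x => ⟨0, zero_vadd B x⟩,
    fun ⟨b, h⟩ => ⟨-b, by rw [← h, neg_vadd_vadd]⟩,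
    fun ⟨b, h⟩ ⟨c, h'⟩ => ⟨c + b, by rw [add_vadd, h, h']⟩⟩
  let q : V₀ → Quotient r := fun a => Quotient.mk r (s a)
  have hqp : ∀ x, q (p x) = Quotient.mk r x := fun x => by
    obtain ⟨a, -, ha⟩ := (hp (s (p x)) x).1 (hs _)
    exact Quotient.sound ⟨a, ha⟩
  have hqs : Function.Surjective q := fun y => by
    induction y using Quotient.inductionOn with
    | h x => exact ⟨p x, hqp x⟩
  have : Finite (Quotient r) := Finite.of_surjective q hqs
  have := Fintype.ofFinite (Quotient r)
  let G' : Quotient r → M := Quotient.lift G (by rintro x _ ⟨b, rfl⟩; exact (hG b x).symm)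
  let g' : Quotient r ≃ Quotient r := Quotient.congr g hg
  -- By freeness, `b ↦ p (b +ᵥ x)` identifies `B ⧸ A` with the `A`-orbits inside the `B`-orbit of
  -- `x`. Sums over `V₀` are thus a fixed multiple of sums over `B`-orbits, which `g` permutes.
  have hcard : ∀ y, (Finset.univ.filter fun a => q a = y).card = Nat.card (B ⧸ A) := by
    intro y
    induction y using Quotient.inductionOn with
    | h x =>
      rw [← Fintype.card_subtype, ← Nat.card_eq_fintype_card]
      symm
      let φ : B ⧸ A → {a // q a = Quotient.mk r x} :=
        Quotient.lift (fun b : B => ⟨p (b +ᵥ x), by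
          rw [hqp]
          exact Quotient.sound ⟨-b, neg_vadd_vadd b x⟩⟩) (by
          intro b c hbc
          have hbc' : -b + c ∈ A := QuotientAddGroup.leftRel_apply.1 hbc
          refine Subtype.ext ((hp _ _).2 ⟨-b + c, hbc', ?_⟩)
          rw [vadd_vadd, add_comm (-b), neg_add_cancel_right])
      refine Nat.card_eq_of_bijective φ ⟨fun b c h => ?_, fun ⟨a, ha⟩ => ?_⟩
      · induction b using Quotient.inductionOn with
        | h b =>
        induction c using Quotient.inductionOn with
        | h c =>
          obtain ⟨a, ha, hax⟩ := (hp _ _).1 (congrArg Subtype.val h)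
          have h0 : (-c + (a + b)) +ᵥ x = x := by
            rw [add_vadd, add_vadd, hax, neg_vadd_vadd]
          have h1 := hfree _ _ h0
          refine Quotient.sound (QuotientAddGroup.leftRel_apply.2 ?_)
          have h2 : -b + c = a := by
            rw [neg_add_eq_zero] at h1
            rw [h1]
            abel
          rwa [h2]
      · obtain ⟨b, hb⟩ := Quotient.exact ha
        refine ⟨Quotient.mk _ (-b), Subtype.ext ?_⟩
        change p (-b +ᵥ x) = a
        rw [← hb, neg_vadd_vadd, hs]
  have hsum : ∀ F : Quotient r → M, ∑ a, F (q a) = Nat.card (B ⧸ A) • ∑ y, F y := by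
    intro F
    rw [← Finset.sum_fiberwise (g := q), Finset.smul_sum]
    refine Finset.sum_congr rfl fun y _ => ?_
    rw [← hcard y, ← Finset.sum_const]
    exact Finset.sum_congr rfl fun a ha => by rw [(Finset.mem_filter.1 ha).2]
  have h1 : ∑ a, G (g (s a)) = ∑ a, (G' ∘ g') (q a) := rfl
  have h2 : ∑ a, G (s a) = ∑ a, G' (q a) := rfl
  rw [h1, h2, hsum, hsum, ← Equiv.sum_comp g' G']
  rfl

/-! ### Harmonicity and tightness of the 1-skeleton -/

namespace Geometry.SimplicialComplex

variable {d : ℕ} {K : SimplicialComplex ℝ (EuclideanSpace ℝ (Fin d))}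

/-- The isometries preserving the 1-skeleton. -/
def skeletonSymmetries (K : SimplicialComplex ℝ (EuclideanSpace ℝ (Fin d))) :
    Subgroup (EuclideanSpace ℝ (Fin d) ≃ᵃⁱ[ℝ] EuclideanSpace ℝ (Fin d)) where
  carrier := {g | (∀ x, g x ∈ K.vertices ↔ x ∈ K.vertices) ∧
    ∀ x y, K.EdgeRel (g x) (g y) ↔ K.EdgeRel x y}
  mul_mem' {a b} ha hb := ⟨fun x => (ha.1 (b x)).trans (hb.1 x),
    fun x y => (ha.2 (b x) (b y)).trans (hb.2 x y)⟩
  one_mem' := ⟨fun _ => Iff.rfl, fun _ _ => Iff.rfl⟩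
  inv_mem' {a} ha := by
    have h : ∀ x, a (a⁻¹ x) = x := a.apply_symm_apply
    exact ⟨fun x => by rw [← ha.1, h], fun x y => by rw [← ha.2, h, h]⟩

theorem IsCoxeterComplex.reflectionGroup_le (hK : K.IsCoxeterComplex) :
    K.reflectionGroup ≤ K.skeletonSymmetries := by
  intro g hg
  have h : ∀ x, g⁻¹ (g x) = x := g.symm_apply_apply
  refine ⟨fun x => ⟨fun hx => ?_, hK.map_vertex hg⟩, fun x y => ⟨fun hx => ?_, hK.map_edge hg⟩⟩
  · rw [← h x]
    exact hK.map_vertex (inv_mem hg) hx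
  · rw [← h x, ← h y]
    exact hK.map_edge (inv_mem hg) hx

/-- The translations preserving the 1-skeleton. -/
abbrev skeletonTranslations (K : SimplicialComplex ℝ (EuclideanSpace ℝ (Fin d))) :
    AddSubgroup (EuclideanSpace ℝ (Fin d)) :=
  translationVectors K.skeletonSymmetries

/-- The sum of a function over the edge vectors at a vertex. -/
noncomputable def edgeSum {M : Type*} [AddCommMonoid M]
    (K : SimplicialComplex ℝ (EuclideanSpace ℝ (Fin d)))
    (φ : EuclideanSpace ℝ (Fin d) → M) (x : EuclideanSpace ℝ (Fin d)) : M :=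
  ∑ᶠ y ∈ {y | K.EdgeRel x y}, φ (y - x)

/-- A symmetry carries the edges at `x` bijectively to those at `g x` and acts on edge vectors by
its linear part. -/
theorem edgeSum_apply_symm {M : Type*} [AddCommMonoid M]
    {g : EuclideanSpace ℝ (Fin d) ≃ᵃⁱ[ℝ] EuclideanSpace ℝ (Fin d)}
    (hg : g ∈ K.skeletonSymmetries) (φ : EuclideanSpace ℝ (Fin d) → M)
    (x : EuclideanSpace ℝ (Fin d)) :
    K.edgeSum φ (g x) = K.edgeSum (fun v => φ (g.linearIsometryEquiv v)) x := by
  symm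
  refine finsum_mem_eq_of_bijOn g ⟨fun y hy => (hg.2 x y).2 hy, g.injective.injOn, fun y hy => ?_⟩
    fun y _ => congrArg φ (g.map_vsub y x)
  obtain ⟨z, rfl⟩ := g.surjective y
  exact ⟨z, (hg.2 x z).1 hy, rfl⟩

/-- Additive equivalences commute with `finsum` without any finiteness of the support. -/
theorem map_edgeSum (φ : EuclideanSpace ℝ (Fin d) → EuclideanSpace ℝ (Fin d))
    (A : EuclideanSpace ℝ (Fin d) ≃ₗᵢ[ℝ] EuclideanSpace ℝ (Fin d))
    (x : EuclideanSpace ℝ (Fin d)) :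
    A (K.edgeSum φ x) = K.edgeSum (fun v => A (φ v)) x := by
  have h : ∀ f : EuclideanSpace ℝ (Fin d) → EuclideanSpace ℝ (Fin d),
      A (∑ᶠ y, f y) = ∑ᶠ y, A (f y) := A.toLinearEquiv.toAddEquiv.map_finsum
  rw [edgeSum, h]
  refine finsum_congr fun y => ?_
  exact A.toLinearEquiv.toAddEquiv.map_finsum _

/-- The sum of the edge vectors at a vertex of a Coxeter complex vanishes. -/
theorem IsCoxeterComplex.edgeSum_id (hd : 1 ≤ d) (hK : K.IsCoxeterComplex)
    {x : EuclideanSpace ℝ (Fin d)} (hx : x ∈ K.vertices) : K.edgeSum id x = 0 := by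
  obtain ⟨s, hs, hxs⟩ := hK.isTriangulation.exists_chamber x
  refine eq_zero_of_fixed hd hs (mem_of_mem_hull hx hs.1 hxs) fun r hr hrx => ?_
  have h := edgeSum_apply_symm (hK.reflectionGroup_le hr) id x
  rw [hrx] at h
  rw [map_edgeSum]
  exact h.symm

/-- The covering map is bijective on the edges leaving `x`, and these correspond to their end
points; sums over the base graph become sums in `ℝᵈ`. -/
theorem finsum_displacement {M : Type*} [AddCommMonoid M]
    (C : TopologicalCrystal K.oneSkeleton.toDirGraph d) {w : C.E₀ → EuclideanSpace ℝ (Fin d)}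
    (hw : ∀ e, w (C.projE e) =
      ((K.oneSkeleton.toDirGraph.t e : K.vertices) : EuclideanSpace ℝ (Fin d)) -
        K.oneSkeleton.toDirGraph.o e)
    (φ : EuclideanSpace ℝ (Fin d) → M) (x : K.vertices) :
    ∑ᶠ f ∈ {f | C.base.o f = C.projV x}, φ (w f) = K.edgeSum φ x := by
  rw [← finsum_mem_eq_of_bijOn C.projE (C.proj_bijOn x) (fun e _ => rfl)]
  refine finsum_mem_eq_of_bijOn (fun e => e.snd.1) ⟨?_, ?_, ?_⟩ ?_
  · rintro e rfl
    exact adj_iff.1 e.adj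
  · intro e he e' he' h
    exact SimpleGraph.Dart.ext _ _ (Prod.ext (he.trans he'.symm) (Subtype.ext h))
  · intro y hy
    obtain ⟨s, hs, hse⟩ := hy.2
    have hys : y ∈ (s : Set (EuclideanSpace ℝ (Fin d))) := by rw [hse]; simp
    exact ⟨⟨(x, ⟨y, mem_vertices_of_mem hs hys⟩), adj_iff.2 hy⟩, rfl, rfl⟩
  · rintro e rfl
    rw [hw]
    rfl

/-- The edge vectors of a Coxeter complex form a tight frame. -/
theorem IsCoxeterComplex.exists_tight (hd : 1 ≤ d) (hK : K.IsCoxeterComplex)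
    (C : TopologicalCrystal K.oneSkeleton.toDirGraph d) [Fintype C.E₀]
    {ρ : C.L →+ EuclideanSpace ℝ (Fin d)}
    (hρ : C.IsPeriodHom (fun x : K.vertices => (x : EuclideanSpace ℝ (Fin d))) ρ)
    {w : C.E₀ → EuclideanSpace ℝ (Fin d)}
    (hw : ∀ e, w (C.projE e) =
      ((K.oneSkeleton.toDirGraph.t e : K.vertices) : EuclideanSpace ℝ (Fin d)) -
        K.oneSkeleton.toDirGraph.o e) :
    ∃ k : ℝ, 0 < k ∧ ∀ u, ∑ f, inner ℝ (w f) u • w f = k • u := by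
  classical
  have := Fintype.ofFinite C.V₀
  let s : C.V₀ → K.vertices := Function.surjInv C.proj_surjective
  have hs : ∀ a, C.projV (s a) = a := Function.surjInv_eq C.proj_surjective
  let S : EuclideanSpace ℝ (Fin d) →ₗ[ℝ] EuclideanSpace ℝ (Fin d) :=
    { toFun := fun u => ∑ f, inner ℝ (w f) u • w f
      map_add' := fun u v => by
        simp only [inner_add_right, add_smul, Finset.sum_add_distrib]
      map_smul' := fun t u => by
        simp only [inner_smul_right, mul_smul, Finset.smul_sum, RingHom.id_apply] }
  have hS : ∀ u, S u = ∑ a, K.edgeSum (fun v => inner ℝ v u • v) (s a) := by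
    intro u
    change ∑ f, inner ℝ (w f) u • w f = _
    rw [← Finset.sum_fiberwise (g := C.base.o)]
    refine Finset.sum_congr rfl fun a _ => ?_
    rw [← finsum_displacement C hw, hs, ← finsum_mem_coe_finset]
    simp
  -- The group of all translations preserving the 1-skeleton contains `ρ(L)` and, unlike `ρ(L)` in
  -- general, is normalized by `Γ`.
  let actV : AddAction K.skeletonTranslations K.vertices :=
    { vadd := fun v x => ⟨v.1 + x.1, (v.2.1 x.1).2 x.2⟩
      zero_vadd := fun x => Subtype.ext (zero_add x.1)
      add_vadd := fun v w x => Subtype.ext (add_assoc v.1 w.1 x.1) }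
  have hρS : ∀ σ, ρ σ ∈ K.skeletonTranslations := by
    have h1 : ∀ σ x, x ∈ K.vertices → ρ σ + x ∈ K.vertices := by
      intro σ x hx
      have h := hρ.2.2.2 σ ⟨x, hx⟩
      rw [add_comm]
      exact h ▸ (σ +ᵥ (⟨x, hx⟩ : K.vertices)).2
    have h2 : ∀ σ x y, K.EdgeRel x y → K.EdgeRel (ρ σ + x) (ρ σ + y) := by
      intro σ x y h
      obtain ⟨hne, t, ht, hte⟩ := h
      have hx : x ∈ K.vertices := mem_vertices_of_mem (x := x) ht
        (Finset.mem_coe.1 (by rw [hte]; simp))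
      have hy : y ∈ K.vertices := mem_vertices_of_mem (x := y) ht
        (Finset.mem_coe.1 (by rw [hte]; simp))
      have hadj : K.oneSkeleton.Adj ⟨x, hx⟩ ⟨y, hy⟩ := adj_iff.2 ⟨hne, t, ht, hte⟩
      let e : K.oneSkeleton.Dart := ⟨(⟨x, hx⟩, ⟨y, hy⟩), hadj⟩
      have h3 := adj_iff.1 (σ +ᵥ e : K.oneSkeleton.Dart).adj
      have ho : (σ +ᵥ e : K.oneSkeleton.Dart).fst = σ +ᵥ (⟨x, hx⟩ : K.vertices) := C.act_o σ e
      have ht' : (σ +ᵥ e : K.oneSkeleton.Dart).snd = σ +ᵥ (⟨y, hy⟩ : K.vertices) := C.act_t σ e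
      rw [ho, ht'] at h3
      have e1 := hρ.2.2.2 σ ⟨x, hx⟩
      have e2 := hρ.2.2.2 σ ⟨y, hy⟩
      simp only at e1 e2
      rwa [e1, e2, add_comm x, add_comm y] at h3
    have h4 : ∀ σ x, ρ (-σ) + (ρ σ + x) = x := fun σ x => by rw [map_neg, neg_add_cancel_left]
    intro σ
    refine ⟨fun x => ⟨fun h => ?_, h1 σ x⟩, fun x y => ⟨fun h => ?_, h2 σ x y⟩⟩
    · rw [← h4 σ x]
      exact h1 (-σ) _ h
    · rw [← h4 σ x, ← h4 σ y]
      exact h2 (-σ) _ _ h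
  have hcomm : ∀ g ∈ K.reflectionGroup, ∀ u,
      S (g.linearIsometryEquiv u) = g.linearIsometryEquiv (S u) := by
    intro g hg u
    have hgS := hK.reflectionGroup_le hg
    let gV : K.vertices ≃ K.vertices :=
      { toFun := fun x => ⟨g x, (hgS.1 x).2 x.2⟩
        invFun := fun x => ⟨g⁻¹ x, ((inv_mem hgS).1 x).2 x.2⟩
        left_inv := fun x => Subtype.ext (g.symm_apply_apply x.1)
        right_inv := fun x => Subtype.ext (g.apply_symm_apply x.1) }
    have hconj : ∀ g ∈ K.skeletonSymmetries, ∀ b ∈ K.skeletonTranslations,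
        g.linearIsometryEquiv b ∈ K.skeletonTranslations := by
      intro g hg b hb
      have : AffineIsometryEquiv.constVAdd ℝ (EuclideanSpace ℝ (Fin d))
          (g.linearIsometryEquiv b) =
          g * AffineIsometryEquiv.constVAdd ℝ (EuclideanSpace ℝ (Fin d)) b * g⁻¹ := by
        refine AffineIsometryEquiv.ext fun x => ?_
        obtain ⟨y, rfl⟩ := g.surjective x
        change _ = g (b + g.symm (g y))
        rw [g.symm_apply_apply]
        exact (g.map_vadd y b).symm
      change AffineIsometryEquiv.constVAdd ℝ (EuclideanSpace ℝ (Fin d))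
          (g.linearIsometryEquiv b) ∈ K.skeletonSymmetries
      rw [this]
      exact mul_mem (mul_mem hg hb) (inv_mem hg)
    have hsum := sum_orbits_comp (B := K.skeletonTranslations)
      (ρ.range.addSubgroupOf K.skeletonTranslations) hs (p := C.projV) (fun x y => ?_)
      (fun b x h => Subtype.ext (add_eq_right.1 (congrArg Subtype.val h))) gV (fun x y => ?_)
      (fun x => K.edgeSum (fun v => inner ℝ v (g.linearIsometryEquiv u) •  v) x.1) (fun b x => ?_)
    · rw [hS, hS, map_sum, ← hsum]
      refine Finset.sum_congr rfl fun a _ => ?_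
      change K.edgeSum _ (g (s a)) = _
      rw [edgeSum_apply_symm hgS, map_edgeSum]
      congr 1
      funext v
      rw [LinearIsometryEquiv.inner_map_map, map_smul]
    · rw [C.projV_eq_iff]
      constructor
      · rintro ⟨σ, rfl⟩
        refine ⟨⟨ρ σ, hρS σ⟩, ⟨σ, rfl⟩, Subtype.ext ?_⟩
        exact (add_comm _ _).trans (hρ.2.2.2 σ x).symm
      · rintro ⟨⟨_, hb⟩, ⟨σ, rfl⟩, rfl⟩
        exact ⟨σ, Subtype.ext ((hρ.2.2.2 σ x).trans (add_comm _ _))⟩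
    · constructor
      · rintro ⟨b, rfl⟩
        exact ⟨⟨_, hconj g hgS b b.2⟩, Subtype.ext (g.map_vadd x.1 b.1).symm⟩
      · rintro ⟨b, hb⟩
        refine ⟨⟨_, hconj g⁻¹ (inv_mem hgS) b b.2⟩, Subtype.ext ?_⟩
        have h1 : b.1 + g x.1 = g y.1 := congrArg Subtype.val hb
        have h2 := g⁻¹.map_vadd (g x.1) b.1
        simp only [vadd_eq_add] at h2
        rw [h1] at h2
        have h3 : ∀ z, g⁻¹ (g z) = z := g.symm_apply_apply
        rw [h3, h3] at h2
        exact h2.symm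
    · change K.edgeSum _ (AffineIsometryEquiv.constVAdd ℝ (EuclideanSpace ℝ (Fin d)) b.1 x.1) = _
      rw [edgeSum_apply_symm b.2]
      rfl
  obtain ⟨t, ht, -⟩ := hK.isTriangulation.exists_chamber 0
  obtain ⟨k, hk⟩ := exists_scalar hd ht S hcomm
  refine ⟨k, ?_, hk⟩
  -- As `d ≥ 1`, a chamber has an edge. Its vector `u` gives `k ‖u‖² = ∑ ⟨w f, u⟩² > 0`.
  obtain ⟨x, hx, y, hy, hxy⟩ := Finset.one_lt_card.1 (show 1 < t.card by rw [ht.2]; omega)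
  let e : K.oneSkeleton.Dart := ⟨(⟨x, mem_vertices_of_mem ht.1 hx⟩, ⟨y, mem_vertices_of_mem ht.1 hy⟩),
    adj_of_mem ht.1 hx hy fun h => hxy (congrArg Subtype.val h)⟩
  have hwe : w (C.projE e) ≠ 0 := by
    rw [hw]
    exact sub_ne_zero.2 (Ne.symm hxy)
  set u := w (C.projE e) with hu
  have h1 : inner ℝ (S u) u = ∑ f, inner ℝ (w f) u ^ 2 := by
    change inner ℝ (∑ f, inner ℝ (w f) u • w f) u = _
    rw [sum_inner]
    exact Finset.sum_congr rfl fun f _ => by rw [real_inner_smul_left, sq]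
  have hu2 : 0 < inner ℝ u u := real_inner_self_pos.2 hwe
  have h2 : 0 < ∑ f, inner ℝ (w f) u ^ 2 :=
    Finset.sum_pos' (fun f _ => sq_nonneg _) ⟨C.projE e, Finset.mem_univ _, pow_pos hu2 2⟩
  rw [← h1, hk, real_inner_smul_left] at h2
  exact pos_of_mul_pos_left h2 hu2.le

end Geometry.SimplicialComplex
-- The theorem
open Geometry in
theorem theorem7p4 {d : ℕ} (hd : 1 ≤ d) (K : SimplicialComplex ℝ (EuclideanSpace ℝ (Fin d)))
    (hK : K.IsCoxeterComplex) :
    (∃ (C : TopologicalCrystal.{0, 0, 0, 0, 0} K.oneSkeleton.toDirGraph d)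
        (ρ : C.L →+ EuclideanSpace ℝ (Fin d)),
        C.IsPeriodHom (fun x : K.vertices => (x : EuclideanSpace ℝ (Fin d))) ρ ∧
        ∀ σ : C.L, AffineIsometryEquiv.constVAdd ℝ (EuclideanSpace ℝ (Fin d)) (ρ σ) ∈
          K.reflectionGroup) ∧
    ∀ C : TopologicalCrystal K.oneSkeleton.toDirGraph d,
      C.IsRealization (fun x : K.vertices => (x : EuclideanSpace ℝ (Fin d))) →
      C.IsStandard (fun x : K.vertices => (x : EuclideanSpace ℝ (Fin d))) := by
  refine ⟨hK.exists_crystal hd, fun C ⟨ρ, hρ⟩ => ?_⟩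
  have := Fintype.ofFinite C.E₀
  obtain ⟨w, hw⟩ := C.exists_displacement hρ
  obtain ⟨k, hk, htight⟩ := hK.exists_tight hd C hρ hw
  refine C.isStandard_of_tight hρ hw (fun a => ?_) hk htight
  obtain ⟨x, rfl⟩ := C.proj_surjective a
  exact (SimplicialComplex.finsum_displacement C hw id x).trans (hK.edgeSum_id hd x.2)
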